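/- Let $K$ be a nonarchimedean local field with separable closure $K^{\mathrm{sep}}$, $\Gamma=\mathrm{Gal}(K^{\mathrm{sep}}|K)$, and let $v$ be the normalized valuation of $K$, extended to $K^{\mathrm{sep}}$. Let $I\subseteq\Gamma$ be the inertia group. Let $\Gamma^s$ ($s\ge -1$) be the usual ramification groups in upper numbering. Put $I^t=I$ for $0\le t<1$, let $I^1$ be the wild inertia group, and put $I^t=\Gamma^{t-1}$ for $t>1$; put $\overline I^t=I^1$ for $0\le t<1$ and $\overline I^t=I^t$ for $t\ge 1$. For $n\ge1$ prime to the residue characteristic, let $\gamma_n:I\to\mu_n(K^{\mathrm{sep}})$ be given by $\gamma_n(\sigma)\equiv\sigma(x)/x$ modulo the maximal ideal, where $v(x)=1/n$. Let $G$ be a finite (discrete) group whose order is not divisible by the characteristic of $K$, let $S_{K,G}$ be the set of continuous homomorphisms $\Gamma\to G$, and let $f\in S_{K,G}$. Put $e_0(f)=\#(f(I)/f(I^1))$, and let $\gamma_f:f(I)\to\mu_{e_0(f)}(K^{\mathrm{sep}})$ be the homomorphism with $\gamma_f(f(\sigma))=\gamma_{e_0(f)}(\sigma)$ for $\sigma\in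 I$. For the character $\psi$ of a finite-dimensional representation of $G$ over $K$ with underlying space $V$, write $\psi(\mathrm{id})=\dim_K V$, and for a subgroup $H\subseteq G$ and a homomorphism $\chi:H\to(K^{\mathrm{sep}})^\times$ let $\langle\psi,\chi\rangle_H=\dim_{K^{\mathrm{sep}}}\mathrm{Hom}_H(\chi,V\otimes_KK^{\mathrm{sep}})\in\mathbb Z_{\ge0}$ be the multiplicity of $\chi$ in $\psi|_H$. The fine Artin conductor is $$f_{\mathrm{fine}}(f,\psi)=\int_0^\infty\bigl(\psi(\mathrm{id})-\langle\psi,\mathrm{triv}\rangle_{f(\overline I^t)}\bigr)\,dt+\sum_{d\mid e_0(f),\ d\ne e_0(f)}\varphi\!\left(\frac{e_0(f)}d\right)\langle\psi,\gamma_f^d\rangle_{f(I)},$$ where $\varphi$ is Euler's function. The integral converges absolutely, and: (a) $f_{\mathrm{fine}}(f,\mathrm{triv})=0$ for the one-dimensional trivial representation. (b) $f_{\mathrm{fine}}(f,\psi_1+\psi_2)=f_{\mathrm{fine}}(f,\psi_1)+f_{\mathrm{fine}}(f,\psi_2)$, where $\psi_1+\psi_2$ belongs to the direct sum of the two representations.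 (c) $f_{\mathrm{fine}}(gfg^{-1},\psi)=f_{\mathrm{fine}}(f,\psi)$ for every $g\in G$, where $gfg^{-1}$ denotes $\sigma\mapsto g\,f(\sigma)\,g^{-1}$. (d) Let $\phi:G_1\to G_2$ be a homomorphism of finite groups whose orders are not divisible by the characteristic of $K$. For every $f\in S_{K,G_1}$ and every character $\psi$ of a finite-dimensional representation of $G_2$ over $K$, $f_{\mathrm{fine}}(\phi\circ f,\psi)=f_{\mathrm{fine}}(f,\psi\circ\phi)$. -/

import Mathlib

open scoped TensorProduct WithZero
open ValuativeRel

noncomputable section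

namespace FineArtin

section Valuation

variable (K : Type*) [Field K] [ValuativeRel K] [TopologicalSpace K] [IsNonarchimedeanLocalField K]

/-- The normalized valuation `v_K(a) ∈ ℤ` of a nonzero element `a` of a nonarchimedean local
field `K` (with the junk value `0` at `a = 0`). -/
def ord (a : K) : ℤ :=
  -WithZero.log (IsNonarchimedeanLocalField.valueGroupWithZeroIsoInt K (valuation K a))

open Classical in
/-- The extension of `v_K` to the separable closure: `v(x) = v_K(N_{K(x)/K}(x)) / [K(x) : K]` for
`x ≠ 0`, where the norm is, up to sign, the constant coefficient of the minimal polynomial;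
`v(0) = ∞`. -/
def sepOrd (x : SeparableClosure K) : WithTop ℝ :=
  if x = 0 then ⊤
  else (((ord K ((minpoly K x).coeff 0) : ℝ) / ((minpoly K x).natDegree : ℝ) : ℝ) : WithTop ℝ)

theorem exists_norm : ∃ N : SeparableClosure K → ℝ,
    (∀ x y, N (x * y) = N x * N y) ∧ (∀ x y, N (x + y) ≤ max (N x) (N y)) ∧
    N 0 = 0 ∧ ∀ x, x ≠ 0 → N x =
      (2 : ℝ) ^ (-((ord K ((minpoly K x).coeff 0) : ℝ) / ((minpoly K x).natDegree : ℝ))) := by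
  let := IsTopologicalAddGroup.rightUniformSpace K
  have := isUniformAddGroup_of_addCommGroup (G := K)
  let j : ℤᵐ⁰ →*₀ NNReal := WithZeroMulInt.toNNReal (e := 2) two_ne_zero
  have hj : StrictMono j := WithZeroMulInt.toNNReal_strictMono (by norm_num)
  let iso := IsNonarchimedeanLocalField.valueGroupWithZeroIsoInt K
  let : (Valued.v (R := K) (Γ₀ := ValueGroupWithZero K)).RankOne :=
  { hom' := (j.comp (iso : ValueGroupWithZero K →*₀o ℤᵐ⁰).toMonoidWithZeroHom).comp
      MonoidWithZeroHom.ValueGroup₀.embedding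
    strictMono' := (hj.comp iso.strictMono).comp
        MonoidWithZeroHom.ValueGroup₀.embedding_strictMono }
  let : NontriviallyNormedField K := Valued.toNontriviallyNormedField K (ValueGroupWithZero K)
  have : IsUltrametricDist K :=
    IsUltrametricDist.isUltrametricDist_of_isNonarchimedean_norm (Valued.isNonarchimedean_norm K _)
  have : CompleteSpace K := inferInstance
  have hnorm : ∀ a : K, a ≠ 0 → ‖a‖ = (2 : ℝ) ^ (-(ord K a : ℝ)) := by
    intro a ha
    have h1 : ‖a‖ = (j (iso (valuation K a)) : ℝ) := by
      rw [Valued.toNormedField.norm_def]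
      simp only [Valuation.RankOne.hom]
      change ((j (iso (MonoidWithZeroHom.ValueGroup₀.embedding
        ((Valued.v (R := K) (Γ₀ := ValueGroupWithZero K)).restrict a))) : NNReal) : ℝ) = _
      rw [Valuation.embedding_restrict]
      rfl
    have h2 : iso (valuation K a) ≠ 0 := by simp [ha]
    rw [h1]
    simp only [j, ord, WithZeroMulInt.toNNReal_neg_apply _ h2, WithZero.toAdd_unzero_eq_log]
    rw [Int.cast_neg, neg_neg, Real.rpow_intCast]
    simp [iso]
  refine ⟨spectralNorm K (SeparableClosure K), fun x y => ?_, fun x y => ?_, ?_, fun x hx => ?_⟩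
  · exact spectralAlgNorm_mul x y
  · exact isNonarchimedean_spectralNorm x y
  · exact spectralNorm_zero
  · rw [spectralNorm.spectralNorm_eq_norm_coeff_zero_rpow, hnorm, ← Real.rpow_mul (by norm_num)]
    · congr 1; ring
    · exact minpoly.coeff_zero_ne_zero (Algebra.IsIntegral.isIntegral x) hx

theorem sepOrd_eq (N : SeparableClosure K → ℝ) (h0 : N 0 = 0) (hN : ∀ x, x ≠ 0 → N x =
      (2 : ℝ) ^ (-((ord K ((minpoly K x).coeff 0) : ℝ) / ((minpoly K x).natDegree : ℝ)))) (x) :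
    sepOrd K x = if N x = 0 then ⊤ else ((-Real.logb 2 (N x) : ℝ) : WithTop ℝ) := by
  by_cases hx : x = 0
  · simp [hx, h0, sepOrd]
  · have : N x ≠ 0 := by rw [hN x hx]; positivity
    rw [if_neg this, sepOrd, if_neg hx, hN x hx, Real.logb_rpow (by norm_num) (by norm_num), neg_neg]

/-- The normalized valuation of `K`, extended to a valuation on the separable closure. -/
def sepVal : AddValuation (SeparableClosure K) (WithTop ℝ) :=
  AddValuation.of (sepOrd K) (by simp [sepOrd])
    (by simp [sepOrd, minpoly.one, ord])
    (by
      obtain ⟨N, hmul, hadd, h0, hN⟩ := exists_norm K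
      have hpos : ∀ x, x ≠ 0 → 0 < N x := fun x hx => by rw [hN x hx]; positivity
      intro x y
      by_cases hx : x = 0
      · subst hx; simp
      by_cases hy : y = 0
      · subst hy; simp
      by_cases hxy : x + y = 0
      · rw [hxy]; simp [sepOrd]
      simp only [sepOrd_eq K N h0 hN, (hpos _ hx).ne', (hpos _ hy).ne', (hpos _ hxy).ne', if_false]
      rcases le_max_iff.1 (hadd x y) with h | h
      · refine (min_le_left _ _).trans (WithTop.coe_le_coe.2 (neg_le_neg ?_))
        exact Real.logb_le_logb_of_le (by norm_num) (hpos _ hxy) h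
      · refine (min_le_right _ _).trans (WithTop.coe_le_coe.2 (neg_le_neg ?_))
        exact Real.logb_le_logb_of_le (by norm_num) (hpos _ hxy) h)
    (by
      obtain ⟨N, hmul, hadd, h0, hN⟩ := exists_norm K
      have hpos : ∀ x, x ≠ 0 → 0 < N x := fun x hx => by rw [hN x hx]; positivity
      intro x y
      by_cases hx : x = 0
      · subst hx; simp [sepOrd]
      by_cases hy : y = 0
      · subst hy; simp [sepOrd]
      simp only [sepOrd_eq K N h0 hN, hmul, (hpos _ hx).ne', (hpos _ hy).ne', mul_eq_zero, or_self,
        if_false, Real.logb_mul (hpos _ hx).ne' (hpos _ hy).ne', neg_add, WithTop.coe_add])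

theorem sepVal_galois (σ : Gal(SeparableClosure K/K)) (x : SeparableClosure K) :
    sepVal K (σ x) = sepVal K x := by
  change sepOrd K (σ x) = sepOrd K x
  by_cases hx : x = 0
  · subst hx; simp
  · have h : σ x ≠ 0 := by simpa using hx
    rw [sepOrd, sepOrd, if_neg hx, if_neg h, minpoly.algEquiv_eq]

end Valuation

section Ramification

variable (K : Type*) [Field K] [ValuativeRel K] [TopologicalSpace K] [IsNonarchimedeanLocalField K]

/-- The inertia group `I` of the separable closure of `K`: the automorphisms acting trivially on
the residue field. -/
def inertia : Subgroup Gal(SeparableClosure K/K) where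
  carrier := {σ | ∀ x, 0 ≤ sepVal K x → 0 < sepVal K (σ x - x)}
  one_mem' := by
    intro x _
    simp
  mul_mem' := by
    intro σ τ hσ hτ x hx
    have h : (σ * τ) x - x = (σ (τ x) - τ x) + (τ x - x) := by simp
    rw [h]
    exact lt_of_lt_of_le (lt_min (hσ _ (by rwa [sepVal_galois])) (hτ x hx))
      ((sepVal K).map_add _ _)
  inv_mem' := by
    intro σ hσ x hx
    have h : σ⁻¹ x - x = -(σ (σ⁻¹ x) - σ⁻¹ x) := by
      rw [← AlgEquiv.mul_apply, mul_inv_cancel]; simp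
    rw [h, AddValuation.map_neg]
    exact hσ _ (by rwa [sepVal_galois])

/-- The value group `v(L^×) ⊆ ℝ` of an intermediate field `L` of the separable closure. -/
def valueGroup (L : IntermediateField K (SeparableClosure K)) : AddSubgroup ℝ :=
  AddSubgroup.closure {r | ∃ x : L, sepVal K (x : SeparableClosure K) = (r : WithTop ℝ)}

/-- The ramification index `e(L|K) = (v(L^×) : v(K^×))`. -/
def ramificationIndex (L : IntermediateField K (SeparableClosure K)) : ℕ :=
  (valueGroup K ⊥).relIndex (valueGroup K L)

/-- The normalized valuation `v_L = e(L|K) v` of a finite extension `L` of `K`. -/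
def fieldVal (L : IntermediateField K (SeparableClosure K)) (x : L) : WithTop ℝ :=
  (sepVal K (x : SeparableClosure K)).map fun r => (ramificationIndex K L : ℝ) * r

variable (L : FiniteGaloisIntermediateField K (SeparableClosure K))

theorem fieldVal_galois (σ : Gal(L/K)) (x : L) :
    fieldVal K L.toIntermediateField (σ x) = fieldVal K L.toIntermediateField x := by
  obtain ⟨τ, rfl⟩ := AlgEquiv.restrictNormalHom_surjective (SeparableClosure K) σ
  rw [fieldVal, fieldVal]
  have h : ((AlgEquiv.restrictNormalHom L τ x : L) : SeparableClosure K) = τ x :=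
    AlgEquiv.restrictNormal_commutes τ L x
  rw [h, sepVal_galois]

theorem fieldVal_add {r : ℝ} {x y : L} (hx : (r : WithTop ℝ) ≤ fieldVal K L.toIntermediateField x)
    (hy : (r : WithTop ℝ) ≤ fieldVal K L.toIntermediateField y) :
    (r : WithTop ℝ) ≤ fieldVal K L.toIntermediateField (x + y) := by
  have h := (sepVal K).map_add (x : SeparableClosure K) y
  have hm : Monotone (WithTop.map fun r : ℝ => (ramificationIndex K L.toIntermediateField : ℝ) * r) :=
    Monotone.withTop_map fun _ _ h => mul_le_mul_of_nonneg_left h (Nat.cast_nonneg _)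
  rcases min_le_iff.1 h with h | h
  · exact hx.trans (hm h)
  · exact hy.trans (hm h)

/-- The ramification group in lower numbering
`G_u(L|K) = {σ ∈ Gal(L|K) : v_L(σ x - x) ≥ u + 1 for all x ∈ 𝒪_L}`, for real `u ≥ -1`. -/
def lowerRamification (u : ℝ) : Subgroup Gal(L/K) where
  carrier := {σ | ∀ x : L, 0 ≤ fieldVal K L.toIntermediateField x →
    ((u + 1 : ℝ) : WithTop ℝ) ≤ fieldVal K L.toIntermediateField (σ x - x)}
  one_mem' := by
    intro x _
    simp [fieldVal]
  mul_mem' := by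
    intro σ τ hσ hτ x hx
    have h : (σ * τ) x - x = (σ (τ x) - τ x) + (τ x - x) := by simp
    rw [h]
    exact fieldVal_add K L (hσ _ (by rwa [fieldVal_galois])) (hτ x hx)
  inv_mem' := by
    intro σ hσ x hx
    have h : σ⁻¹ x - x = -(σ (σ⁻¹ x) - σ⁻¹ x) := by
      rw [← AlgEquiv.mul_apply, mul_inv_cancel]; simp
    have h2 := hσ (σ⁻¹ x) (by rwa [fieldVal_galois])
    rw [h, fieldVal, NegMemClass.coe_neg, AddValuation.map_neg]
    exact h2

/-- The Herbrand function `φ_{L|K}(u) = ∫₀ᵘ dt / (G_0 : G_t)`, for `u ≥ -1`. -/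
def herbrand (u : ℝ) : ℝ :=
  ∫ t in (0 : ℝ)..u, (((lowerRamification K L t).relIndex (lowerRamification K L 0) : ℕ) : ℝ)⁻¹

/-- The ramification group in upper numbering `G^s(L|K) = G_u(L|K)` with `s = φ_{L|K}(u)`, that is
`u = φ_{L|K}⁻¹(s)`, for `s ≥ -1`. -/
def upperRamification (s : ℝ) : Subgroup Gal(L/K) :=
  lowerRamification K L (Function.invFunOn (herbrand K L) (Set.Ici (-1)) s)

/-- The ramification group in upper numbering of the separable closure,
`G_K^s = {σ : σ|_L ∈ G^s(L|K) for all finite Galois extensions L of K}`. -/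
def absUpperRamification (s : ℝ) : Subgroup Gal(SeparableClosure K/K) :=
  ⨅ L : FiniteGaloisIntermediateField K (SeparableClosure K),
    (upperRamification K L s).comap (AlgEquiv.restrictNormalHom L)

/-- The wild inertia group of the separable closure,
`{σ : σ|_L ∈ G_1(L|K) for all finite Galois extensions L of K}`. -/
def wildInertia : Subgroup Gal(SeparableClosure K/K) :=
  ⨅ L : FiniteGaloisIntermediateField K (SeparableClosure K),
    (lowerRamification K L 1).comap (AlgEquiv.restrictNormalHom L)

/-- The groups `I^t`, `t ≥ 0`, numbered such that `I^t = I` for `0 ≤ t < 1`, such that `I^1` is the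
wild inertia group, and such that `∫₀^∞ (ψ(id) - ⟨ψ, triv⟩_{f(I^t)}) dt` is the usual Artin
conductor. This is the usual upper numbering shifted by one. -/
def shiftedRamification (t : ℝ) : Subgroup Gal(SeparableClosure K/K) :=
  if t < 1 then inertia K else if t = 1 then wildInertia K else absUpperRamification K (t - 1)

/-- `Ī^t = I^1` for `0 ≤ t < 1` and `Ī^t = I^t` for `t ≥ 1`. -/
def truncatedRamification (t : ℝ) : Subgroup Gal(SeparableClosure K/K) :=
  if t < 1 then shiftedRamification K 1 else shiftedRamification K t

/-- `γ_n(σ)` for `σ ∈ I`: the `n`-th root of unity `ζ` with `ζ ≡ σ(x)/x` modulo the maximal ideal,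
for every `x` of valuation `1/n`. Used for `n ≥ 1` prime to the residue characteristic. -/
def tameCharacter (n : ℕ) (σ : inertia K) : rootsOfUnity n (SeparableClosure K) :=
  Classical.epsilon fun ζ => ∀ x : SeparableClosure K, sepVal K x = ((1 / n : ℝ) : WithTop ℝ) →
    0 < sepVal K ((σ : Gal(SeparableClosure K/K)) x / x - ((ζ : (SeparableClosure K)ˣ) : _))

end Ramification

section Pairing

/-- The inner product `⟨ψ₁, ψ₂⟩_H` of the characters of two representations of `H` over a
field `F`, as the dimension of the space of `H`-equivariant maps. (If `F` has characteristic zero and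
`τ` is absolutely irreducible, this is the number `|H|⁻¹ ∑ ψ₁(h) ψ₂(h⁻¹)`; in positive
characteristic that sum, taken in `F`, would only see the multiplicity modulo the characteristic.) -/
def pairing {F H V W : Type*} [Field F] [Group H] [AddCommGroup V] [Module F V] [AddCommGroup W]
    [Module F W] (ρ : Representation F H V) (τ : Representation F H W) : ℕ :=
  Module.finrank F (τ.IntertwiningMap ρ)

/-- Extension of scalars of a representation. -/
def extendScalars {F H V : Type*} (E : Type*) [Field F] [Field E] [Algebra F E] [Group H]
    [AddCommGroup V] [Module F V] (ρ : Representation F H V) : Representation E H (E ⊗[F] V) :=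
  ((Module.End.baseChangeHom F E V : Module.End F V →ₐ[F] _) : Module.End F V →* _).comp ρ

/-- The one-dimensional representation given by `χ : H → Fˣ`. -/
def ofCharacter {F H : Type*} [Field F] [Group H] (χ : H →* Fˣ) : Representation F H F :=
  ((Algebra.lmul F F : F →ₐ[F] Module.End F F) : F →* Module.End F F).comp
    ((Units.coeHom F).comp χ)

end Pairing

section Conductor

variable {K : Type*} [Field K] [ValuativeRel K] [TopologicalSpace K] [IsNonarchimedeanLocalField K]
variable {G : Type*} [Group G] [TopologicalSpace G]

/-- The subgroup `f(I) ⊆ G`. -/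
def inertiaImage (f : Gal(SeparableClosure K/K) →ₜ* G) : Subgroup G :=
  (inertia K).map (f : Gal(SeparableClosure K/K) →* G)

/-- The order `e₀(f)` of `f(I)/f(I^1)`. -/
def tameIndex (f : Gal(SeparableClosure K/K) →ₜ* G) : ℕ :=
  ((shiftedRamification K 1).map (f : Gal(SeparableClosure K/K) →* G)).relIndex (inertiaImage f)

/-- The homomorphism `γ_f : f(I) → μ_{e₀(f)}` with `γ_f(f(σ)) = γ_{e₀(f)}(σ)` for `σ ∈ I`. -/
def tameHom (f : Gal(SeparableClosure K/K) →ₜ* G) :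
    inertiaImage f →* rootsOfUnity (tameIndex f) (SeparableClosure K) :=
  Classical.epsilon fun γ => ∀ σ : inertia K,
    γ ⟨f σ, Subgroup.mem_map_of_mem (f : Gal(SeparableClosure K/K) →* G) σ.2⟩ =
      tameCharacter K (tameIndex f) σ

variable {V : Type*} [AddCommGroup V] [Module K V]

/-- `⟨ψ, χ⟩_H` for the character `ψ` of a representation of `G` over `K` and a one-dimensional
character `χ` of a subgroup `H` over the separable closure of `K`. -/
def charPairing (ρ : Representation K G V) (H : Subgroup G) (χ : H →* (SeparableClosure K)ˣ) : ℕ :=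
  pairing ((extendScalars (SeparableClosure K) ρ).comp H.subtype) (ofCharacter χ)

/-- The integrand `ψ(id) - ⟨ψ, triv⟩_{f(Ī^t)}`. -/
def conductorIntegrand (f : Gal(SeparableClosure K/K) →ₜ* G) (ρ : Representation K G V)
    (t : ℝ) : ℝ :=
  (Module.finrank K V : ℝ) -
    charPairing ρ ((truncatedRamification K t).map (f : Gal(SeparableClosure K/K) →* G)) 1

/-- The fine Artin conductor of `f` with respect to a representation of `G` over `K`. -/
def fineConductor (f : Gal(SeparableClosure K/K) →ₜ* G) (ρ : Representation K G V) : ℝ :=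
  (∫ t in Set.Ioi (0 : ℝ), conductorIntegrand f ρ t) +
    ∑ d ∈ (tameIndex f).properDivisors, (Nat.totient (tameIndex f / d) : ℝ) *
      charPairing ρ (inertiaImage f)
        (((rootsOfUnity (tameIndex f) (SeparableClosure K)).subtype.comp (tameHom f)) ^ d)

/-- The composition `φ ∘ f`. -/
def postcomp [DiscreteTopology G] {G' : Type*} [Group G'] [TopologicalSpace G'] (φ : G →* G')
    (f : Gal(SeparableClosure K/K) →ₜ* G) : Gal(SeparableClosure K/K) →ₜ* G' where
  toMonoidHom := φ.comp (f : Gal(SeparableClosure K/K) →* G)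
  continuous_toFun := (continuous_of_discreteTopology (f := φ)).comp f.continuous_toFun

/-- The conjugate `g f g⁻¹`. -/
def conjugate [DiscreteTopology G] (g : G) (f : Gal(SeparableClosure K/K) →ₜ* G) :
    Gal(SeparableClosure K/K) →ₜ* G where
  toFun σ := g * f σ * g⁻¹
  map_one' := by simp
  map_mul' σ τ := by simp [mul_assoc]
  continuous_toFun := (continuous_of_discreteTopology (f := fun h : G => g * h * g⁻¹)).comp
    f.continuous_toFun

end Conductor

end FineArtin

end

/-!
Functoriality under group homomorphisms is the main point: vanishing on the trivial representation
and conjugation invariance are the cases of the homomorphism to the trivial group and of inner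
automorphisms (`fineConductor_trivial`, `fineConductor_conjugate`). Multiplicities of
one-dimensional characters are computed as dimensions of isotypic subspaces, from which additivity
is clear.

The integral transforms trivially under `φ`. For the finite sum one needs to know the tame quotient
`f(I)/f(I^1)`: `tameIndex_spec` says that its order `e₀(f)` is prime to the residue characteristic
`p` and that `γ_{e₀(f)}` identifies it with the group of roots of unity of order `e₀(f)`. Granting
this, `γ_f` exists and has full order, and `γ_{φ ∘ f} ∘ φ = γ_f ^ k` for
`k = e₀(f) / e₀(φ ∘ f)`. The divisors `d` of `e₀(φ ∘ f)` correspond to the divisors `d k` of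
`e₀(f)`, with equal coefficients, and every other `γ_f ^ d` is nontrivial on the kernel of `φ`, so
does not occur in a representation that factors through `φ`.

The proof of `tameIndex_spec` rests on the residue class `twist σ x` of `σ(x)/x`, which for `σ` in
the inertia group is multiplicative in `x` and depends only on the valuation of `x`. An
automorphism is in the wild inertia group if and only if all its twists are trivial
(`mem_wildInertia_iff`). Let `L` be the extension cut out by `f` and `n` the prime-to-`p` part of
`e(L|K)`. As the residue field has no nontrivial `p`-power roots of unity, `γ_n(σ) = 1` means that all twists
of `σ` on `L` are trivial. Then `f(σ)` has `p`-power order by a trace argument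
(`galois_eq_of_wild_of_pow`), and, by compactness of the Galois group, the `p`-primary component of
`σ` is a wild element with the same image (`exists_mem_wildInertia_map_eq`). Finally, `γ_n` is
surjective because the fixed field of inertia is unramified over `K`
(`sepVal_int_of_fixed_inertia`): it is generated by roots of unity of order prime to `p`, whose
conjugates have distinct residue classes.

For the integrability, the Herbrand functions are strictly increasing with slopes between a positive
constant and `1`, so the upper ramification groups decrease and are eventually killed by `f`
(`exists_absUpperRamification_le_ker`). The integrand is thus piecewise monotone, bounded and of
bounded support.
-/

noncomputable section

namespace FineArtin

/-! ### The residue field of the separable closure -/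

section ResidueField

variable {K : Type*} [Field K] [ValuativeRel K] [TopologicalSpace K] [IsNonarchimedeanLocalField K]

theorem exists_sepVal_eq {x : SeparableClosure K} (hx : x ≠ 0) :
    ∃ r : ℝ, sepVal K x = (r : WithTop ℝ) := by
  obtain ⟨r, hr⟩ := WithTop.ne_top_iff_exists.1 ((sepVal K).ne_top_iff.2 hx)
  exact ⟨r, hr.symm⟩

theorem sepVal_eq_zero_of_pow_eq_one {x : SeparableClosure K} {n : ℕ} (hn : n ≠ 0)
    (hx : x ^ n = 1) : sepVal K x = 0 := by
  have h0 : x ≠ 0 := by rintro rfl; simp [hn] at hx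
  obtain ⟨r, hr⟩ := exists_sepVal_eq h0
  have h := congrArg (sepVal K) hx
  rw [AddValuation.map_pow, AddValuation.map_one, hr] at h
  rw [hr]
  norm_cast at h ⊢
  simpa [hn] using h

variable (K) in
/-- The valuation ring of the separable closure. -/
def sepInteger : ValuationSubring (SeparableClosure K) :=
  (AddValuation.toValuation (sepVal K)).valuationSubring

theorem mem_sepInteger {x : SeparableClosure K} : x ∈ sepInteger K ↔ 0 ≤ sepVal K x :=
  Valuation.mem_valuationSubring_iff _ _

variable (K) in
/-- The residue field of the separable closure. -/
abbrev SepResidue : Type _ := IsLocalRing.ResidueField (sepInteger K)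

open Classical in
/-- The residue class of an element of the separable closure, with the junk value `0` at elements
that are not integral. -/
def res (x : SeparableClosure K) : SepResidue K :=
  if h : x ∈ sepInteger K then IsLocalRing.residue _ ⟨x, h⟩ else 0

theorem res_of_mem {x : SeparableClosure K} (h : x ∈ sepInteger K) :
    res x = IsLocalRing.residue _ ⟨x, h⟩ := dif_pos h

theorem res_coe (x : sepInteger K) : res (x : SeparableClosure K) = IsLocalRing.residue _ x :=
  res_of_mem x.2

theorem res_add {x y : SeparableClosure K} (hx : 0 ≤ sepVal K x) (hy : 0 ≤ sepVal K y) :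
    res (x + y) = res x + res y := by
  rw [← mem_sepInteger] at hx hy
  rw [res_of_mem hx, res_of_mem hy, res_of_mem (add_mem hx hy), ← map_add]
  rfl

theorem res_sub {x y : SeparableClosure K} (hx : 0 ≤ sepVal K x) (hy : 0 ≤ sepVal K y) :
    res (x - y) = res x - res y := by
  rw [← mem_sepInteger] at hx hy
  rw [res_of_mem hx, res_of_mem hy, res_of_mem (sub_mem hx hy), ← map_sub]
  rfl

theorem res_mul {x y : SeparableClosure K} (hx : 0 ≤ sepVal K x) (hy : 0 ≤ sepVal K y) :
    res (x * y) = res x * res y := by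
  rw [← mem_sepInteger] at hx hy
  rw [res_of_mem hx, res_of_mem hy, res_of_mem (mul_mem hx hy), ← map_mul]
  rfl

theorem res_one : res (1 : SeparableClosure K) = 1 := by
  rw [res_of_mem (one_mem _)]
  exact map_one _

theorem res_pow {x : SeparableClosure K} (hx : 0 ≤ sepVal K x) (n : ℕ) :
    res (x ^ n) = res x ^ n := by
  rw [← mem_sepInteger] at hx
  rw [res_of_mem hx, res_of_mem (pow_mem hx n), ← map_pow]
  rfl

theorem res_natCast (n : ℕ) : res (n : SeparableClosure K) = n := by
  rw [res_of_mem (natCast_mem _ n), ← map_natCast (IsLocalRing.residue (sepInteger K))]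
  rfl

theorem res_eq_zero_iff {x : SeparableClosure K} (hx : 0 ≤ sepVal K x) :
    res x = 0 ↔ 0 < sepVal K x := by
  have hm := mem_sepInteger.2 hx
  rw [res_of_mem hm, IsLocalRing.residue_eq_zero_iff, IsLocalRing.mem_maximalIdeal,
    mem_nonunits_iff]
  constructor
  · intro h
    refine lt_of_le_of_ne hx fun h0 => h ?_
    have hx0 : x ≠ 0 := by
      rintro rfl
      rw [AddValuation.map_zero] at h0
      exact absurd h0 (by simp)
    have hi : x⁻¹ ∈ sepInteger K := by
      rw [mem_sepInteger, AddValuation.map_inv, ← h0]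
      simp
    exact IsUnit.of_mul_eq_one ⟨x⁻¹, hi⟩ (Subtype.ext (mul_inv_cancel₀ hx0))
  · rintro h ⟨u, hu⟩
    have h1 : x * ((↑u⁻¹ : sepInteger K) : SeparableClosure K) = 1 := by
      have := congrArg (Subtype.val) u.mul_inv
      rwa [hu] at this
    have h2 := congrArg (sepVal K) h1
    rw [AddValuation.map_mul, AddValuation.map_one] at h2
    have h3 : 0 ≤ sepVal K ((↑u⁻¹ : sepInteger K) : SeparableClosure K) :=
      mem_sepInteger.1 (↑u⁻¹ : sepInteger K).2
    have := add_pos_of_pos_of_nonneg h h3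
    rw [h2] at this
    exact lt_irrefl _ this

theorem res_eq_iff {x y : SeparableClosure K} (hx : 0 ≤ sepVal K x) (hy : 0 ≤ sepVal K y) :
    res x = res y ↔ 0 < sepVal K (x - y) := by
  rw [← res_eq_zero_iff ((sepVal K).map_le_sub hx hy), res_sub hx hy, sub_eq_zero]

/-- The valuation of an element of the base field is its normalized valuation. -/
theorem sepVal_algebraMap {a : K} (ha : a ≠ 0) :
    sepVal K (algebraMap K (SeparableClosure K) a) = ((ord K a : ℝ) : WithTop ℝ) := by
  change sepOrd K _ = _
  rw [sepOrd, if_neg (by simpa using ha), minpoly.eq_X_sub_C]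
  simp [ord, Valuation.map_neg]

theorem sepVal_algebraMap_nonneg_iff {a : K} :
    0 ≤ sepVal K (algebraMap K (SeparableClosure K) a) ↔ valuation K a ≤ 1 := by
  by_cases ha : a = 0
  · simp [ha]
  rw [sepVal_algebraMap ha]
  have h0 : IsNonarchimedeanLocalField.valueGroupWithZeroIsoInt K (valuation K a) ≠ 0 := by
    simp [ha]
  have h1 : valuation K a ≤ 1 ↔
      IsNonarchimedeanLocalField.valueGroupWithZeroIsoInt K (valuation K a) ≤ 1 := by
    rw [← map_one (IsNonarchimedeanLocalField.valueGroupWithZeroIsoInt K)]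
    exact (OrderIso.le_iff_le
      (IsNonarchimedeanLocalField.valueGroupWithZeroIsoInt K).toOrderIso).symm
  rw [h1, ← WithZero.log_le_log h0 one_ne_zero, WithZero.log_one]
  norm_cast
  simp [ord]

variable (K) in
theorem exists_ord_eq_one : ∃ a : K, a ≠ 0 ∧ ord K a = 1 := by
  obtain ⟨γ, hγ⟩ := (IsNonarchimedeanLocalField.valueGroupWithZeroIsoInt K).surjective
    (WithZero.exp (-1))
  obtain ⟨a, ha⟩ := ValuativeRel.valuation_surjective (K := K) γ
  replace hγ : IsNonarchimedeanLocalField.valueGroupWithZeroIsoInt K γ = WithZero.exp (-1) := hγ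
  have : ord K a = 1 := by
    rw [ord, ha, hγ]
    simp
  refine ⟨a, ?_, this⟩
  rintro rfl
  simp [ord] at this

variable (K) in
theorem exists_sepVal_algebraMap_eq_one :
    ∃ a : K, sepVal K (algebraMap K (SeparableClosure K) a) = ((1 : ℝ) : WithTop ℝ) := by
  obtain ⟨a, ha, h⟩ := exists_ord_eq_one K
  exact ⟨a, by rw [sepVal_algebraMap ha, h]; simp⟩

variable (K) in
/-- The inclusion of valuation rings. -/
def integerMap : 𝒪[K] →+* sepInteger K :=
  ((algebraMap K (SeparableClosure K)).comp (𝒪[K]).subtype).codRestrict (sepInteger K).toSubring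
    fun a => mem_sepInteger.2 (sepVal_algebraMap_nonneg_iff.2 a.2)

instance isLocalHom_integerMap : IsLocalHom (integerMap K) := by
  refine ⟨fun a ha => ?_⟩
  by_contra h
  have h1 : (a : K) ≠ 0 := by
    intro h0
    have : a = 0 := Subtype.ext h0
    rw [this, map_zero] at ha
    exact not_isUnit_zero ha
  have h2 : res ((integerMap K a : sepInteger K) : SeparableClosure K) ≠ 0 := by
    rw [res_coe]
    exact (ha.map _).ne_zero
  have h3 : 0 < sepVal K (algebraMap K (SeparableClosure K) a) := by
    refine lt_of_le_of_ne (sepVal_algebraMap_nonneg_iff.2 a.2) fun h4 => h ?_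
    have h5 : valuation K (a : K)⁻¹ ≤ 1 := by
      rw [← sepVal_algebraMap_nonneg_iff, map_inv₀, AddValuation.map_inv, ← h4]
      simp
    refine IsUnit.of_mul_eq_one ⟨(a : K)⁻¹, h5⟩ ?_
    ext
    exact mul_inv_cancel₀ h1
  exact h2 ((res_eq_zero_iff h3.le).2 h3)

/-- The residue field of the separable closure as an extension of the residue field of `K`. -/
instance algebraSepResidue : Algebra 𝓀[K] (SepResidue K) :=
  (IsLocalRing.ResidueField.map (integerMap K)).toAlgebra

end ResidueField

/-! ### Roots of unity of order prime to the residue characteristic -/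

section RootsOfUnity

variable {K : Type*} [Field K] [ValuativeRel K] [TopologicalSpace K] [IsNonarchimedeanLocalField K]

theorem residueChar_prime : (ringChar 𝓀[K]).Prime :=
  CharP.char_is_prime 𝓀[K] _

instance charP_sepResidue : CharP (SepResidue K) (ringChar 𝓀[K]) :=
  charP_of_injective_algebraMap (algebraMap 𝓀[K] (SepResidue K)).injective _

theorem natCast_sepResidue_ne_zero {n : ℕ} (hn : n.Coprime (ringChar 𝓀[K])) :
    (n : SepResidue K) ≠ 0 := by
  rw [Ne, CharP.cast_eq_zero_iff (SepResidue K) (ringChar 𝓀[K])]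
  exact (Nat.Prime.coprime_iff_not_dvd residueChar_prime).1 hn.symm

theorem natCast_sep_ne_zero {n : ℕ} (hn : n.Coprime (ringChar 𝓀[K])) :
    (n : SeparableClosure K) ≠ 0 := by
  intro h
  have h1 := res_natCast (K := K) n
  rw [h, (res_eq_zero_iff (by simp)).2 (by simp)] at h1
  exact natCast_sepResidue_ne_zero hn h1.symm

theorem ne_zero_of_coprime {n : ℕ} (hn : n.Coprime (ringChar 𝓀[K])) : n ≠ 0 := by
  rintro rfl
  exact natCast_sep_ne_zero hn (by simp)

theorem res_sum {ι : Type*} (s : Finset ι) (g : ι → SeparableClosure K)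
    (h : ∀ i ∈ s, 0 ≤ sepVal K (g i)) : res (∑ i ∈ s, g i) = ∑ i ∈ s, res (g i) := by
  classical
  induction s using Finset.induction_on with
  | empty => simpa using (res_eq_zero_iff (K := K) (x := 0) (by simp)).2 (by simp)
  | insert a s ha ih =>
    rw [Finset.sum_insert ha, Finset.sum_insert ha, res_add (h _ (by simp)), ih]
    · exact fun i hi => h i (by simp [hi])
    · exact (sepVal K).map_le_sum fun i hi => h i (by simp [hi])

theorem sepVal_pow_nonneg {x : SeparableClosure K} (h : 0 ≤ sepVal K x) (n : ℕ) :
    0 ≤ sepVal K (x ^ n) :=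
  mem_sepInteger.1 (pow_mem (mem_sepInteger.2 h) n)

theorem sepVal_mul_nonneg {x y : SeparableClosure K} (h : 0 ≤ sepVal K x) (h' : 0 ≤ sepVal K y) :
    0 ≤ sepVal K (x * y) :=
  mem_sepInteger.1 (mul_mem (mem_sepInteger.2 h) (mem_sepInteger.2 h'))

theorem sepVal_geom_sum₂_nonneg {a b : SeparableClosure K} (ha : 0 ≤ sepVal K a)
    (hb : 0 ≤ sepVal K b) (n : ℕ) :
    0 ≤ sepVal K (∑ i ∈ Finset.range n, a ^ i * b ^ (n - 1 - i)) :=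
  (sepVal K).map_le_sum fun _ _ =>
    sepVal_mul_nonneg (sepVal_pow_nonneg ha _) (sepVal_pow_nonneg hb _)

/-- For `a ≡ b` modulo the maximal ideal, `(aⁿ - bⁿ) / (a - b) ≡ n aⁿ⁻¹`. -/
theorem res_geom_sum₂ {a b : SeparableClosure K} (ha : 0 ≤ sepVal K a) (hb : 0 ≤ sepVal K b)
    (hab : res a = res b) (n : ℕ) :
    res (∑ i ∈ Finset.range n, a ^ i * b ^ (n - 1 - i)) = n * res a ^ (n - 1) := by
  rw [res_sum, ← geom_sum₂_self]
  · refine Finset.sum_congr rfl fun i _ => ?_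
    rw [res_mul (sepVal_pow_nonneg ha _) (sepVal_pow_nonneg hb _), res_pow ha, res_pow hb, hab]
  · exact fun _ _ => sepVal_mul_nonneg (sepVal_pow_nonneg ha _) (sepVal_pow_nonneg hb _)

/-- Roots of unity of order prime to the residue characteristic are determined by their residue
classes. -/
theorem eq_of_res_eq_of_pow_eq_one {n : ℕ} (hn : n.Coprime (ringChar 𝓀[K]))
    {a b : SeparableClosure K} (ha : a ^ n = 1) (hb : b ^ n = 1) (hab : res a = res b) : a = b := by
  have hn0 := ne_zero_of_coprime hn
  have ha' := (sepVal_eq_zero_of_pow_eq_one hn0 ha)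
  have hb' := (sepVal_eq_zero_of_pow_eq_one hn0 hb)
  have h := (Commute.all a b).geom_sum₂_mul n
  rw [ha, hb, sub_self, mul_eq_zero] at h
  rcases h with h | h
  · exfalso
    have h1 := res_geom_sum₂ ha'.ge hb'.ge hab n
    rw [h, (res_eq_zero_iff (by simp)).2 (by simp)] at h1
    refine mul_ne_zero (natCast_sepResidue_ne_zero hn) (pow_ne_zero _ fun h2 => ?_) h1.symm
    rw [res_eq_zero_iff ha'.ge, ha'] at h2
    exact lt_irrefl _ h2
  · exact sub_eq_zero.1 h

open Polynomial in
/-- A nonzero polynomial over `K` is, up to a nonzero factor, integral with nonzero reduction. -/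
theorem exists_primitive_multiple {P : K[X]} (hP : P ≠ 0) :
    ∃ c : K, c ≠ 0 ∧ ∃ Q : (𝒪[K])[X], Q.map (𝒪[K]).subtype = C c * P ∧
      Q.map (IsLocalRing.residue 𝒪[K]) ≠ 0 := by
  -- Divide by a coefficient of least order, that is of largest multiplicative valuation.
  obtain ⟨i, hi, hmax⟩ := P.support.exists_max_image (fun i => valuation K (P.coeff i))
    (Polynomial.support_nonempty.2 hP)
  have hi0 : P.coeff i ≠ 0 := Polynomial.mem_support_iff.1 hi
  have hv : valuation K (P.coeff i) ≠ 0 := by simpa using hi0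
  have hint : ↑(C (P.coeff i)⁻¹ * P).coeffs ⊆ (𝒪[K] : Set K) := by
    intro a ha
    obtain ⟨j, hj, rfl⟩ := Polynomial.mem_coeffs_iff.1 ha
    rw [coeff_C_mul]
    have hj' : j ∈ P.support := by
      rw [Polynomial.mem_support_iff, coeff_C_mul] at hj
      exact Polynomial.mem_support_iff.2 (right_ne_zero_of_mul hj)
    change valuation K _ ≤ 1
    rw [map_mul, map_inv₀, mul_comm]
    exact mul_inv_le_one_of_le₀ (hmax j hj') zero_le
  refine ⟨(P.coeff i)⁻¹, inv_ne_zero hi0, (C (P.coeff i)⁻¹ * P).toSubring 𝒪[K] hint, ?_, ?_⟩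
  · ext n
    simp
  · intro h
    have h1 := congrArg (fun q => q.coeff i) h
    have h2 : ((C (P.coeff i)⁻¹ * P).toSubring 𝒪[K] hint).coeff i = 1 := by
      ext
      simp [hi0]
    simp [h2] at h1

open Polynomial in
theorem res_aeval (Q : (𝒪[K])[X]) {x : SeparableClosure K} (hx : 0 ≤ sepVal K x) :
    0 ≤ sepVal K (aeval x (Q.map (𝒪[K]).subtype)) ∧
    res (aeval x (Q.map (𝒪[K]).subtype)) =
      aeval (res x) (Q.map (IsLocalRing.residue 𝒪[K])) := by
  have hm := mem_sepInteger.2 hx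
  have h1 : aeval x (Q.map (𝒪[K]).subtype) =
      ((Q.eval₂ (integerMap K) ⟨x, hm⟩ : sepInteger K) : SeparableClosure K) := by
    have := Polynomial.hom_eval₂ Q (integerMap K) (sepInteger K).subtype ⟨x, hm⟩
    rw [aeval_def, eval₂_map]
    exact this.symm
  refine ⟨?_, ?_⟩
  · rw [h1]
    exact mem_sepInteger.1 (Subtype.property _)
  · rw [h1, res_coe, Polynomial.hom_eval₂, aeval_def, eval₂_map, res_of_mem hm]
    congr 1

open Polynomial in
/-- The residue field of the separable closure is algebraic over a finite field. -/
theorem isAlgebraic_res {x : SeparableClosure K} (hx : 0 ≤ sepVal K x) :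
    IsAlgebraic 𝓀[K] (res x) := by
  obtain ⟨c, -, Q, hQ, hQ0⟩ := exists_primitive_multiple
    (minpoly.ne_zero (Algebra.IsIntegral.isIntegral (R := K) x))
  refine ⟨_, hQ0, ?_⟩
  rw [← (res_aeval Q hx).2, hQ, map_mul, minpoly.aeval, mul_zero, res_eq_zero_iff (by simp)]
  simp

/-- The residue class of a unit lies in a finite field, hence is a root of unity of order prime to
the residue characteristic. -/
theorem exists_pow_res_eq_one {x : SeparableClosure K} (hx : sepVal K x = 0) :
    ∃ n : ℕ, n.Coprime (ringChar 𝓀[K]) ∧ res x ^ n = 1 := by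
  have halg := (isAlgebraic_res hx.ge).isIntegral
  have := IntermediateField.adjoin.finiteDimensional halg
  have : Finite (IntermediateField.adjoin 𝓀[K] {res x}) := Module.finite_of_finite 𝓀[K]
  have := Fintype.ofFinite (IntermediateField.adjoin 𝓀[K] {res x})
  have : CharP (IntermediateField.adjoin 𝓀[K] {res x}) (ringChar 𝓀[K]) :=
    charP_of_injective_algebraMap (algebraMap 𝓀[K] _).injective _
  refine ⟨Fintype.card (IntermediateField.adjoin 𝓀[K] {res x}) - 1, ?_, ?_⟩
  · obtain ⟨n, hp, hn⟩ := FiniteField.card (IntermediateField.adjoin 𝓀[K] {res x}) (ringChar 𝓀[K])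
    rw [Nat.coprime_comm, Nat.Prime.coprime_iff_not_dvd hp, hn]
    intro h
    have h1 : ringChar 𝓀[K] ∣ ringChar 𝓀[K] ^ (n : ℕ) := dvd_pow_self _ n.ne_zero
    have h2 := (Nat.dvd_sub_iff_right (Nat.one_le_pow _ _ hp.pos) h1).1 h
    exact hp.one_lt.ne' (Nat.dvd_one.1 h2)
  · have h0 : (IntermediateField.AdjoinSimple.gen 𝓀[K] (res x)) ≠ 0 := by
      intro h
      have h1 := congrArg Subtype.val h
      rw [IntermediateField.AdjoinSimple.coe_gen] at h1
      have h2 := (res_eq_zero_iff hx.ge).1 h1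
      rw [hx] at h2
      exact lt_irrefl _ h2
    have := FiniteField.pow_card_sub_one_eq_one _ h0
    simpa using congrArg Subtype.val this

/-- Every unit is congruent to a root of unity of order prime to the residue characteristic. -/
theorem exists_rootOfUnity_res_eq {x : SeparableClosure K} (hx : sepVal K x = 0) :
    ∃ n : ℕ, n.Coprime (ringChar 𝓀[K]) ∧ ∃ ζ : SeparableClosure K, ζ ^ n = 1 ∧ res x = res ζ := by
  obtain ⟨n, hn, h1⟩ := exists_pow_res_eq_one hx
  have hn0 := ne_zero_of_coprime hn
  have : NeZero (n : SeparableClosure K) := ⟨natCast_sep_ne_zero hn⟩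
  obtain ⟨ξ, hξ⟩ := HasEnoughRootsOfUnity.exists_primitiveRoot (SeparableClosure K) n
  refine ⟨n, hn, ?_⟩
  by_contra! hcon
  -- `xⁿ - 1` is the product of the `x - ζ`, so one factor lies in the maximal ideal.
  have h2 := hξ.pow_sub_pow_eq_prod_sub_mul x 1 (Nat.pos_of_ne_zero hn0)
  have h3 : 0 < sepVal K (x ^ n - 1 ^ n) := by
    rw [one_pow, ← res_eq_iff (sepVal_pow_nonneg hx.ge n) (by simp), res_pow hx.ge, h1, res_one]
  rw [h2] at h3
  refine absurd h3 (not_lt.2 ?_)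
  refine Finset.prod_induction _ (fun y => sepVal K y ≤ 0) (fun a b ha hb => ?_) (by simp)
    fun ζ hζ => ?_
  · rw [AddValuation.map_mul]
    exact add_nonpos ha hb
  · have hζ1 : ζ ^ n = 1 := (Polynomial.mem_nthRootsFinset (Nat.pos_of_ne_zero hn0) _).1 hζ
    rw [mul_one, ← not_lt, ← res_eq_iff hx.ge (sepVal_eq_zero_of_pow_eq_one hn0 hζ1).ge]
    exact hcon ζ hζ1

theorem res_galois {σ : Gal(SeparableClosure K/K)} (hσ : σ ∈ inertia K) {x : SeparableClosure K}
    (hx : 0 ≤ sepVal K x) : res (σ x) = res x := by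
  rw [res_eq_iff (by rwa [sepVal_galois]) hx]
  exact hσ x hx

/-- An automorphism that fixes the roots of unity of order prime to the residue characteristic
lies in the inertia group. -/
theorem mem_inertia_of_fixes_rootsOfUnity {σ : Gal(SeparableClosure K/K)}
    (h : ∀ n : ℕ, n.Coprime (ringChar 𝓀[K]) → ∀ ζ : SeparableClosure K, ζ ^ n = 1 → σ ζ = ζ) :
    σ ∈ inertia K := by
  intro x hx
  rcases hx.eq_or_lt with h0 | h0
  · obtain ⟨n, hn, ζ, hζ, hx'⟩ := exists_rootOfUnity_res_eq h0.symm
    have h1 := (res_eq_iff hx (sepVal_eq_zero_of_pow_eq_one (ne_zero_of_coprime hn) hζ).ge).1 hx'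
    have h2 : σ x - x = σ (x - ζ) - (x - ζ) := by
      rw [map_sub, h n hn ζ hζ]
      ring
    rw [h2]
    exact lt_of_lt_of_le (lt_min (by rwa [sepVal_galois]) h1) ((sepVal K).map_sub _ _)
  · exact lt_of_lt_of_le (lt_min (by rwa [sepVal_galois]) h0) ((sepVal K).map_sub _ _)

open Polynomial in
/-- Adjoining a root of unity of order prime to the residue characteristic is unramified: since
the conjugates of `ζ` have distinct residue classes, the reduction of a polynomial of smaller
degree than the minimal polynomial of `ζ` cannot vanish at all of them. -/
theorem sepVal_int_of_mem_adjoin_rootOfUnity {n : ℕ} (hn : n.Coprime (ringChar 𝓀[K]))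
    {ζ : SeparableClosure K} (hζ : ζ ^ n = 1) {y : SeparableClosure K} (hy0 : y ≠ 0)
    (hy : y ∈ IntermediateField.adjoin K {ζ}) : ∃ m : ℤ, sepVal K y = ((m : ℝ) : WithTop ℝ) := by
  have hn0 := ne_zero_of_coprime hn
  have hint : IsIntegral K ζ := Algebra.IsIntegral.isIntegral ζ
  obtain ⟨P, hP, hdeg⟩ : ∃ P : K[X], aeval ζ P = y ∧ P.degree < (minpoly K ζ).degree := by
    have h1 : y ∈ Algebra.adjoin K {ζ} := by
      rwa [← IntermediateField.adjoin_simple_toSubalgebra_of_isAlgebraic hint.isAlgebraic]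
    rw [Algebra.adjoin_singleton_eq_range_aeval] at h1
    obtain ⟨P, hP⟩ := h1
    refine ⟨P %ₘ minpoly K ζ, ?_, degree_modByMonic_lt _ (minpoly.monic hint)⟩
    rw [← hP]
    exact aeval_modByMonic_eq_self_of_root (minpoly.aeval K ζ)
  have hP0 : P ≠ 0 := by
    rintro rfl
    exact hy0 (by rw [← hP, map_zero])
  obtain ⟨c, hc, Q, hQ, hQ0⟩ := exists_primitive_multiple hP0
  have hroot : ∀ z ∈ (minpoly K ζ).rootSet (SeparableClosure K),
      ∃ σ : Gal(SeparableClosure K/K), z = σ ζ := by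
    intro z hz
    have h2 : minpoly K ζ = minpoly K z :=
      minpoly.eq_of_irreducible_of_monic (minpoly.irreducible hint)
        (mem_rootSet.1 hz).2 (minpoly.monic hint)
    obtain ⟨σ, hσ⟩ := (Normal.minpoly_eq_iff_mem_orbit (F := K) (E := SeparableClosure K)).1 h2.symm
    exact ⟨σ, hσ.symm⟩
  have hpow : ∀ z ∈ (minpoly K ζ).rootSet (SeparableClosure K), z ^ n = 1 := by
    intro z hz
    obtain ⟨σ, rfl⟩ := hroot z hz
    rw [← map_pow, hζ, map_one]
  have hval : sepVal K (aeval ζ (Q.map (𝒪[K]).subtype)) = 0 := by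
    have hle := (res_aeval Q (sepVal_eq_zero_of_pow_eq_one hn0 hζ).ge).1
    refine hle.antisymm' (not_lt.1 fun hlt => hQ0 ?_)
    have h3 : (Q.map (IsLocalRing.residue 𝒪[K])).map (algebraMap 𝓀[K] (SepResidue K)) = 0 := by
      refine Polynomial.eq_zero_of_natDegree_lt_card_of_eval_eq_zero _
        (ι := (minpoly K ζ).rootSet (SeparableClosure K))
        (f := fun z => res (z : SeparableClosure K)) ?_ ?_ ?_
      · intro z w hzw
        exact Subtype.ext (eq_of_res_eq_of_pow_eq_one hn (hpow _ z.2) (hpow _ w.2) hzw)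
      · rintro ⟨z, hz⟩
        obtain ⟨σ, rfl⟩ := hroot z hz
        have h4 : 0 ≤ sepVal K (σ ζ) := (sepVal_eq_zero_of_pow_eq_one hn0 (hpow _ hz)).ge
        have h5 := (res_aeval Q h4)
        have h6 : aeval (σ ζ) (Q.map (𝒪[K]).subtype) = σ (aeval ζ (Q.map (𝒪[K]).subtype)) :=
          aeval_algHom_apply (σ : SeparableClosure K →ₐ[K] SeparableClosure K) ζ _
        rw [eval_map_algebraMap, ← h5.2, res_eq_zero_iff h5.1, h6, sepVal_galois]
        exact hlt
      · rw [card_rootSet_eq_natDegree (Algebra.IsSeparable.isSeparable K ζ)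
          (IsSepClosed.splits_codomain _ (Algebra.IsSeparable.isSeparable K ζ)), natDegree_map]
        refine natDegree_map_le.trans_lt ?_
        have h6 : Q.natDegree = (C c * P).natDegree := by
          rw [← hQ, natDegree_map_eq_of_injective Subtype.val_injective]
        rw [h6, natDegree_C_mul hc]
        exact natDegree_lt_natDegree hP0 hdeg
    exact (Polynomial.map_eq_zero _).1 h3
  rw [hQ, map_mul, hP, aeval_C, AddValuation.map_mul, sepVal_algebraMap hc] at hval
  obtain ⟨r, hr⟩ := exists_sepVal_eq hy0
  rw [hr] at hval ⊢
  refine ⟨-ord K c, ?_⟩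
  norm_cast at hval ⊢
  push_cast
  linarith

/-- The fixed field of the inertia group is unramified over `K`. -/
theorem sepVal_int_of_fixed_inertia {y : SeparableClosure K} (hy0 : y ≠ 0)
    (hy : ∀ σ ∈ inertia K, σ y = y) : ∃ m : ℤ, sepVal K y = ((m : ℝ) : WithTop ℝ) := by
  -- By infinite Galois theory the fixed field is generated by roots of unity, and `y` needs only
  -- finitely many of them, all powers of a single one.
  let S : Set (SeparableClosure K) := {ζ | ∃ n : ℕ, n.Coprime (ringChar 𝓀[K]) ∧ ζ ^ n = 1}
  have h1 : y ∈ IntermediateField.adjoin K S := by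
    rw [← InfiniteGalois.fixedField_fixingSubgroup (IntermediateField.adjoin K S)]
    rintro ⟨σ, hσ⟩
    refine hy σ (mem_inertia_of_fixes_rootsOfUnity fun n hn ζ hζ => ?_)
    exact hσ ⟨ζ, IntermediateField.subset_adjoin K S ⟨n, hn, hζ⟩⟩
  obtain ⟨T, hTS, hT⟩ := IntermediateField.exists_finset_of_mem_adjoin h1
  have hTS' : ∀ ζ, ζ ∈ T → ∃ n : ℕ, n.Coprime (ringChar 𝓀[K]) ∧ ζ ^ n = 1 := fun ζ hζ => hTS hζ
  choose! N hN using hTS'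
  have hcop : (∏ ζ ∈ T, N ζ).Coprime (ringChar 𝓀[K]) :=
    Nat.Coprime.prod_left fun ζ hζ => (hN _ hζ).1
  have : NeZero ((∏ ζ ∈ T, N ζ : ℕ) : SeparableClosure K) := ⟨natCast_sep_ne_zero hcop⟩
  have : NeZero (∏ ζ ∈ T, N ζ) := ⟨ne_zero_of_coprime hcop⟩
  obtain ⟨ξ, hξ⟩ := HasEnoughRootsOfUnity.exists_primitiveRoot (SeparableClosure K) (∏ ζ ∈ T, N ζ)
  refine sepVal_int_of_mem_adjoin_rootOfUnity hcop hξ.pow_eq_one hy0 ?_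
  refine (IntermediateField.adjoin_le_iff.2 fun ζ hζ => ?_) hT
  obtain ⟨k, hk⟩ := Finset.dvd_prod_of_mem N hζ
  obtain ⟨i, -, rfl⟩ := hξ.eq_pow_of_pow_eq_one (ξ := ζ) (by rw [hk, pow_mul, (hN _ hζ).2, one_pow])
  exact pow_mem (IntermediateField.mem_adjoin_simple_self K ξ) i

end RootsOfUnity

/-! ### Value groups of finite extensions -/

section ValueGroup

variable {K : Type*} [Field K] [ValuativeRel K] [TopologicalSpace K] [IsNonarchimedeanLocalField K]

theorem mem_valueGroup_iff {L : IntermediateField K (SeparableClosure K)} {r : ℝ} :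
    r ∈ valueGroup K L ↔ ∃ x : L, sepVal K (x : SeparableClosure K) = (r : WithTop ℝ) := by
  refine ⟨fun h => ?_, fun h => AddSubgroup.subset_closure h⟩
  refine AddSubgroup.closure_induction (fun _ h => h) ⟨1, by simp⟩ ?_ ?_ h
  · rintro r s - - ⟨x, hx⟩ ⟨y, hy⟩
    exact ⟨x * y, by simp [hx, hy]⟩
  · rintro r - ⟨x, hx⟩
    refine ⟨x⁻¹, ?_⟩
    rw [IntermediateField.coe_inv, AddValuation.map_inv, hx]
    rfl

theorem valueGroup_bot : valueGroup K ⊥ = AddSubgroup.zmultiples 1 := by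
  ext r
  rw [mem_valueGroup_iff, AddSubgroup.mem_zmultiples_iff]
  constructor
  · rintro ⟨⟨x, hx⟩, hr⟩
    obtain ⟨a, rfl⟩ := IntermediateField.mem_bot.1 hx
    have ha : a ≠ 0 := by
      rintro rfl
      simp at hr
    refine ⟨ord K a, ?_⟩
    simp only [sepVal_algebraMap ha] at hr
    simpa using WithTop.coe_injective hr
  · rintro ⟨n, rfl⟩
    have h1 : (1 : ℝ) ∈ valueGroup K ⊥ := by
      obtain ⟨a, ha⟩ := exists_sepVal_algebraMap_eq_one K
      exact mem_valueGroup_iff.2 ⟨⟨_, IntermediateField.mem_bot.2 ⟨a, rfl⟩⟩, ha⟩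
    exact mem_valueGroup_iff.1 (zsmul_mem h1 n)

/-- The value group of a finite extension `L` is generated by `1 / e(L|K)`. -/
theorem valueGroup_eq (L : IntermediateField K (SeparableClosure K)) [FiniteDimensional K L] :
    0 < ramificationIndex K L ∧
      valueGroup K L = AddSubgroup.zmultiples (1 / (ramificationIndex K L : ℝ)) := by
  -- Both value groups lie in `(1/n)ℤ`, so that their index can be computed in `ℤ`.
  set n := Module.finrank K L with hn
  have hn0 : 0 < n := Module.finrank_pos
  have hnR : (n : ℝ) ≠ 0 := by positivity
  let j : ℤ →+ ℝ := (AddMonoidHom.mulLeft (1 / (n : ℝ))).comp (Int.castAddHom ℝ)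
  have hj : ∀ m : ℤ, j m = m / n := fun m => by
    simp only [j, AddMonoidHom.coe_comp, Function.comp_apply, AddMonoidHom.coe_mulLeft,
      Int.coe_castAddHom]
    ring
  have hinj : Function.Injective j := fun a b hab => by
    rw [hj, hj, div_left_inj' hnR] at hab
    exact_mod_cast hab
  have hle : valueGroup K L ≤ j.range := by
    intro r hr
    obtain ⟨x, hx⟩ := mem_valueGroup_iff.1 hr
    have hx0 : (x : SeparableClosure K) ≠ 0 := by
      intro h
      rw [h, AddValuation.map_zero] at hx
      exact WithTop.top_ne_coe hx
    have hdvd : (minpoly K (x : SeparableClosure K)).natDegree ∣ n := by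
      rw [hn, ← IntermediateField.minpoly_eq]
      exact minpoly.degree_dvd (Algebra.IsIntegral.isIntegral x)
    obtain ⟨k, hk⟩ := hdvd
    change sepOrd K _ = _ at hx
    rw [sepOrd, if_neg hx0] at hx
    refine ⟨ord K ((minpoly K (x : SeparableClosure K)).coeff 0) * k, ?_⟩
    rw [hj, ← WithTop.coe_injective hx, hk]
    have hk0 : (k : ℝ) ≠ 0 := by
      intro h
      apply hnR
      rw [hk]
      push_cast
      rw [h, mul_zero]
    push_cast
    rw [mul_div_mul_right _ _ hk0]
  obtain ⟨d, hd⟩ := Int.subgroup_cyclic ((valueGroup K L).comap j)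
  rw [← AddSubgroup.zmultiples_eq_closure] at hd
  have hmap : valueGroup K L = (AddSubgroup.zmultiples d).map j := by
    rw [← hd, AddSubgroup.map_comap_eq, inf_eq_right.2 hle]
  have hbot : valueGroup K ⊥ = (AddSubgroup.zmultiples (n : ℤ)).map j := by
    rw [valueGroup_bot, AddMonoidHom.map_zmultiples, hj]
    congr 1
    push_cast
    field_simp
  have hbl : AddSubgroup.zmultiples (n : ℤ) ≤ AddSubgroup.zmultiples d := by
    rw [← AddSubgroup.map_le_map_iff_of_injective hinj, ← hmap, ← hbot]
    intro r hr
    obtain ⟨⟨x, hx⟩, hr⟩ := mem_valueGroup_iff.1 hr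
    exact mem_valueGroup_iff.2 ⟨⟨x, (bot_le : ⊥ ≤ L) hx⟩, hr⟩
  have hidx : ramificationIndex K L * d.natAbs = n := by
    have := AddSubgroup.relIndex_mul_index hbl
    rw [Int.index_zmultiples, Int.index_zmultiples, Int.natAbs_natCast] at this
    rw [ramificationIndex, hmap, hbot, AddSubgroup.relIndex_map_map_of_injective _ _ hinj, this]
  have hpos : 0 < ramificationIndex K L := by
    rcases Nat.eq_zero_or_pos (ramificationIndex K L) with h | h
    · rw [h, zero_mul] at hidx
      omega
    · exact h
  refine ⟨hpos, ?_⟩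
  have hd0 : (d.natAbs : ℝ) ≠ 0 := by
    intro h
    apply hnR
    rw [← hidx]
    push_cast
    rw [h, mul_zero]
  have he0 : (ramificationIndex K L : ℝ) ≠ 0 := by positivity
  have hjd : j (d.natAbs : ℤ) = 1 / (ramificationIndex K L : ℝ) := by
    rw [hj, ← hidx, Int.cast_natCast, Nat.cast_mul]
    field_simp
  rw [hmap, ← Int.zmultiples_natAbs, AddMonoidHom.map_zmultiples, hjd]

theorem exists_sepVal_eq_inv_ramificationIndex (L : IntermediateField K (SeparableClosure K))
    [FiniteDimensional K L] :
    ∃ x ∈ L, sepVal K x = ((1 / (ramificationIndex K L : ℝ) : ℝ) : WithTop ℝ) := by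
  have h : (1 / (ramificationIndex K L : ℝ)) ∈ valueGroup K L := by
    rw [(valueGroup_eq L).2]
    exact AddSubgroup.mem_zmultiples _
  obtain ⟨x, hx⟩ := mem_valueGroup_iff.1 h
  exact ⟨x, x.2, hx⟩

theorem exists_sepVal_eq_div (L : IntermediateField K (SeparableClosure K))
    [FiniteDimensional K L] {x : SeparableClosure K} (hx : x ∈ L) (hx0 : x ≠ 0) :
    ∃ m : ℤ, sepVal K x = ((m / (ramificationIndex K L : ℝ) : ℝ) : WithTop ℝ) := by
  obtain ⟨r, hr⟩ := exists_sepVal_eq hx0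
  have h : r ∈ valueGroup K L := mem_valueGroup_iff.2 ⟨⟨x, hx⟩, hr⟩
  rw [(valueGroup_eq L).2] at h
  obtain ⟨m, rfl⟩ := AddSubgroup.mem_zmultiples_iff.1 h
  exact ⟨m, by rw [hr]; simp [div_eq_mul_inv]⟩

end ValueGroup

/-! ### Tame characters -/

section Tame

variable {K : Type*} [Field K] [ValuativeRel K] [TopologicalSpace K] [IsNonarchimedeanLocalField K]

/-- The residue class of `σ(x)/x`. For fixed `σ` in the inertia group it is multiplicative in `x`
and depends only on the valuation of `x`. -/
def twist (σ : Gal(SeparableClosure K/K)) (x : SeparableClosure K) : SepResidue K :=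
  res (σ x / x)

theorem sepVal_galois_div (σ : Gal(SeparableClosure K/K)) {x : SeparableClosure K} (hx : x ≠ 0) :
    sepVal K (σ x / x) = 0 := by
  obtain ⟨r, hr⟩ := exists_sepVal_eq hx
  rw [AddValuation.map_div, sepVal_galois, hr]
  norm_cast
  simp

theorem twist_mul (σ : Gal(SeparableClosure K/K)) {x y : SeparableClosure K} (hx : x ≠ 0)
    (hy : y ≠ 0) : twist σ (x * y) = twist σ x * twist σ y := by
  rw [twist, map_mul, mul_div_mul_comm,
    res_mul (sepVal_galois_div σ hx).ge (sepVal_galois_div σ hy).ge]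
  rfl

theorem twist_pow (σ : Gal(SeparableClosure K/K)) {x : SeparableClosure K} (hx : x ≠ 0) (n : ℕ) :
    twist σ (x ^ n) = twist σ x ^ n := by
  rw [twist, map_pow, ← div_pow, res_pow (sepVal_galois_div σ hx).ge]
  rfl

theorem twist_galois_mul {σ : Gal(SeparableClosure K/K)} (hσ : σ ∈ inertia K)
    (τ : Gal(SeparableClosure K/K)) {x : SeparableClosure K} (hx : x ≠ 0) :
    twist (σ * τ) x = twist σ x * twist τ x := by
  have h : (σ * τ) x / x = σ (τ x / x) * (σ x / x) := by
    have : σ x ≠ 0 := by simpa using hx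
    rw [map_div₀, AlgEquiv.mul_apply]
    field_simp
  rw [twist, h, res_mul (by rw [sepVal_galois, sepVal_galois_div τ hx])
    (sepVal_galois_div σ hx).ge, res_galois hσ (sepVal_galois_div τ hx).ge, mul_comm]
  rfl

theorem twist_one {x : SeparableClosure K} (hx : x ≠ 0) :
    twist (1 : Gal(SeparableClosure K/K)) x = 1 := by
  rw [twist, AlgEquiv.one_apply, div_self hx, res_one]

theorem twist_galois_pow {σ : Gal(SeparableClosure K/K)} (hσ : σ ∈ inertia K)
    {x : SeparableClosure K} (hx : x ≠ 0) (n : ℕ) : twist (σ ^ n) x = twist σ x ^ n := by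
  induction n with
  | zero => simp [twist_one hx]
  | succ n ih => rw [pow_succ, twist_galois_mul (pow_mem hσ n) _ hx, ih, pow_succ]

theorem twist_eq_one_iff (σ : Gal(SeparableClosure K/K)) {x : SeparableClosure K} (hx : x ≠ 0) :
    twist σ x = 1 ↔ sepVal K x < sepVal K (σ x - x) := by
  rw [twist, ← res_one, res_eq_iff (sepVal_galois_div σ hx).ge (by simp), div_sub_one hx,
    AddValuation.map_div]
  obtain ⟨r, hr⟩ := exists_sepVal_eq hx
  rw [hr]
  generalize sepVal K (σ x - x) = s
  induction s using WithTop.recTopCoe with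
  | top =>
    have : (⊤ : WithTop ℝ) - (r : WithTop ℝ) = ⊤ := rfl
    simp [this]
  | coe s =>
    norm_cast
    exact sub_pos

theorem twist_eq_one_of_sepVal_eq_zero {σ : Gal(SeparableClosure K/K)} (hσ : σ ∈ inertia K)
    {x : SeparableClosure K} (hx : sepVal K x = 0) : twist σ x = 1 := by
  have hx0 : x ≠ 0 := by
    rintro rfl
    simp at hx
  rw [twist_eq_one_iff σ hx0, hx]
  exact hσ x hx.ge

theorem twist_congr {σ : Gal(SeparableClosure K/K)} (hσ : σ ∈ inertia K)
    {x y : SeparableClosure K} (hx : x ≠ 0) (h : sepVal K x = sepVal K y) :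
    twist σ x = twist σ y := by
  have hy : y ≠ 0 := by
    rintro rfl
    rw [AddValuation.map_zero] at h
    exact hx ((sepVal K).top_iff.1 h)
  have h1 : sepVal K (x / y) = 0 := by
    obtain ⟨r, hr⟩ := exists_sepVal_eq hy
    rw [AddValuation.map_div, h, hr]
    norm_cast
    simp
  have h2 := twist_mul σ (div_ne_zero hx hy) hy
  rwa [div_mul_cancel₀ _ hy, twist_eq_one_of_sepVal_eq_zero hσ h1, one_mul] at h2

theorem ne_zero_of_sepVal_eq {x : SeparableClosure K} {r : ℝ} (h : sepVal K x = (r : WithTop ℝ)) :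
    x ≠ 0 := by
  rintro rfl
  rw [AddValuation.map_zero] at h
  exact WithTop.top_ne_coe h

theorem sepVal_pow_eq {x : SeparableClosure K} {r : ℝ} (h : sepVal K x = (r : WithTop ℝ)) (n : ℕ) :
    sepVal K (x ^ n) = ((n * r : ℝ) : WithTop ℝ) := by
  rw [AddValuation.map_pow, h, ← WithTop.coe_nsmul, nsmul_eq_mul]

variable (K) in
theorem exists_pow_eq_uniformizer {n : ℕ} (hn : n.Coprime (ringChar 𝓀[K])) :
    ∃ x : SeparableClosure K, sepVal K x = ((1 / n : ℝ) : WithTop ℝ) ∧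
      ∃ a : K, x ^ n = algebraMap K _ a := by
  obtain ⟨a, ha⟩ := exists_sepVal_algebraMap_eq_one K
  have : NeZero (n : SeparableClosure K) := ⟨natCast_sep_ne_zero hn⟩
  obtain ⟨x, hx⟩ := IsSepClosed.exists_pow_nat_eq (algebraMap K (SeparableClosure K) a) n
  refine ⟨x, ?_, a, hx⟩
  have hn0 : (n : ℝ) ≠ 0 := by
    exact_mod_cast ne_zero_of_coprime hn
  have hx0 : x ≠ 0 := by
    rintro rfl
    rw [zero_pow (ne_zero_of_coprime hn)] at hx
    rw [← hx] at ha
    exact ne_zero_of_sepVal_eq ha rfl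
  obtain ⟨r, hr⟩ := exists_sepVal_eq hx0
  have h := congrArg (sepVal K) hx
  rw [sepVal_pow_eq hr, ha] at h
  rw [hr, ← WithTop.coe_injective h]
  congr 1
  field_simp

theorem galois_div_pow_eq_one {K : Type*} [Field K] {n : ℕ} {x : SeparableClosure K} (hx : x ≠ 0)
    {a : K} (ha : x ^ n = algebraMap K _ a) (σ : Gal(SeparableClosure K/K)) :
    (σ x / x) ^ n = 1 := by
  rw [div_pow, ← map_pow, ha, AlgEquiv.commutes, ← ha, div_self (pow_ne_zero _ hx)]

theorem coe_rootsOfUnity_pow_eq_one {K : Type*} [Field K] {n : ℕ}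
    (ζ : rootsOfUnity n (SeparableClosure K)) :
    (((ζ : (SeparableClosure K)ˣ)) : SeparableClosure K) ^ n = 1 := by
  rw [← Units.val_pow_eq_pow_val, (mem_rootsOfUnity n _).1 ζ.2, Units.val_one]

/-- The defining congruence of the tame character: in residue classes, `γ_n(σ) = σ(x)/x` for every
`x` of valuation `1/n`. -/
theorem res_tameCharacter {n : ℕ} (hn : n.Coprime (ringChar 𝓀[K])) (σ : inertia K)
    {x : SeparableClosure K} (hx : sepVal K x = ((1 / n : ℝ) : WithTop ℝ)) :
    res (((tameCharacter K n σ : (SeparableClosure K)ˣ)) : SeparableClosure K) = twist σ x := by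
  have hex : ∃ ζ : rootsOfUnity n (SeparableClosure K), ∀ x : SeparableClosure K,
      sepVal K x = ((1 / n : ℝ) : WithTop ℝ) →
      0 < sepVal K ((σ : Gal(SeparableClosure K/K)) x / x - ((ζ : (SeparableClosure K)ˣ) : _)) := by
    obtain ⟨y, hy, a, ha⟩ := exists_pow_eq_uniformizer K hn
    have hy0 := ne_zero_of_sepVal_eq hy
    have hζ := galois_div_pow_eq_one hy0 ha σ
    have : NeZero n := ⟨ne_zero_of_coprime hn⟩
    refine ⟨rootsOfUnity.mkOfPowEq _ hζ, fun x hx => ?_⟩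
    have hx0 := ne_zero_of_sepVal_eq hx
    rw [rootsOfUnity.val_mkOfPowEq_coe, ← res_eq_iff (sepVal_galois_div _ hx0).ge
      (sepVal_galois_div _ hy0).ge]
    exact twist_congr σ.2 hx0 (hx.trans hy.symm)
  have h := Classical.epsilon_spec hex x hx
  have hx0 := ne_zero_of_sepVal_eq hx
  rw [← res_eq_iff (sepVal_galois_div _ hx0).ge (sepVal_eq_zero_of_pow_eq_one
    (ne_zero_of_coprime hn) (coe_rootsOfUnity_pow_eq_one _)).ge] at h
  exact h.symm

theorem rootsOfUnity_ext {n : ℕ} (hn : n.Coprime (ringChar 𝓀[K]))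
    {a b : (SeparableClosure K)ˣ} (ha : a ^ n = 1) (hb : b ^ n = 1)
    (h : res (a : SeparableClosure K) = res (b : SeparableClosure K)) : a = b :=
  Units.ext (eq_of_res_eq_of_pow_eq_one hn (by rw [← Units.val_pow_eq_pow_val, ha, Units.val_one])
    (by rw [← Units.val_pow_eq_pow_val, hb, Units.val_one]) h)

/-- The tame character `γ_n` as a homomorphism. -/
def tameCharacterHom {n : ℕ} (hn : n.Coprime (ringChar 𝓀[K])) :
    inertia K →* rootsOfUnity n (SeparableClosure K) :=
  MonoidHom.mk' (tameCharacter K n) fun σ τ => by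
    obtain ⟨x, hx, -⟩ := exists_pow_eq_uniformizer K hn
    have hv : ∀ ζ : rootsOfUnity n (SeparableClosure K),
        0 ≤ sepVal K (((ζ : (SeparableClosure K)ˣ)) : SeparableClosure K) := fun ζ =>
      (sepVal_eq_zero_of_pow_eq_one (ne_zero_of_coprime hn) (coe_rootsOfUnity_pow_eq_one _)).ge
    refine Subtype.ext (rootsOfUnity_ext hn ((mem_rootsOfUnity n _).1 (Subtype.property _))
      ((mem_rootsOfUnity n _).1 (Subtype.property _)) ?_)
    rw [Subgroup.coe_mul, Units.val_mul, res_mul (hv _) (hv _), res_tameCharacter hn σ hx,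
      res_tameCharacter hn τ hx, res_tameCharacter hn (σ * τ) hx, Subgroup.coe_mul,
      twist_galois_mul σ.2 _ (ne_zero_of_sepVal_eq hx)]

theorem tameCharacterHom_apply {n : ℕ} (hn : n.Coprime (ringChar 𝓀[K])) (σ : inertia K) :
    tameCharacterHom hn σ = tameCharacter K n σ := rfl

theorem tameCharacter_eq_one_iff {n : ℕ} (hn : n.Coprime (ringChar 𝓀[K])) (σ : inertia K)
    {x : SeparableClosure K} (hx : sepVal K x = ((1 / n : ℝ) : WithTop ℝ)) :
    tameCharacter K n σ = 1 ↔ twist σ x = 1 := by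
  rw [← res_tameCharacter hn σ hx]
  constructor
  · intro h
    rw [h]
    exact res_one
  · intro h
    refine Subtype.ext (rootsOfUnity_ext hn ((mem_rootsOfUnity n _).1 (Subtype.property _))
      (one_pow n) ?_)
    rw [h]
    exact res_one.symm

/-- Compatibility of the tame characters: `γ_{nm}^m = γ_n`. -/
theorem tameCharacter_mul_pow {n m : ℕ} (hnm : (n * m).Coprime (ringChar 𝓀[K])) (σ : inertia K) :
    (tameCharacter K (n * m) σ : (SeparableClosure K)ˣ) ^ m = tameCharacter K n σ := by
  have hn : n.Coprime (ringChar 𝓀[K]) := hnm.coprime_mul_right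
  have hm : m.Coprime (ringChar 𝓀[K]) := hnm.coprime_mul_left
  have hm0 : (m : ℝ) ≠ 0 := by exact_mod_cast ne_zero_of_coprime hm
  have hn0 : (n : ℝ) ≠ 0 := by exact_mod_cast ne_zero_of_coprime hn
  obtain ⟨x, hx, -⟩ := exists_pow_eq_uniformizer K hnm
  have hx0 := ne_zero_of_sepVal_eq hx
  have hxm : sepVal K (x ^ m) = ((1 / n : ℝ) : WithTop ℝ) := by
    rw [sepVal_pow_eq hx]
    congr 1
    push_cast
    field_simp
  refine rootsOfUnity_ext hn ?_ ((mem_rootsOfUnity n _).1 (Subtype.property _)) ?_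
  · rw [← pow_mul, mul_comm m n]
    exact (mem_rootsOfUnity _ _).1 (Subtype.property _)
  · rw [Units.val_pow_eq_pow_val, res_pow (sepVal_eq_zero_of_pow_eq_one
      (ne_zero_of_coprime hnm) (coe_rootsOfUnity_pow_eq_one _)).ge, res_tameCharacter hnm σ hx,
      res_tameCharacter hn σ hxm, twist_pow _ hx0]

/-- The tame character `γ_n` is surjective: if its image had order `m`, then for `xⁿ` a uniformizer
of `K`, the element `xᵐ` of valuation `m/n` would be fixed by inertia. -/
theorem exists_orderOf_tameCharacter_eq {n : ℕ} (hn : n.Coprime (ringChar 𝓀[K])) :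
    ∃ σ : inertia K, orderOf (tameCharacter K n σ) = n := by
  have hn0 := ne_zero_of_coprime hn
  have : NeZero n := ⟨hn0⟩
  obtain ⟨x, hx, a, ha⟩ := exists_pow_eq_uniformizer K hn
  have hx0 := ne_zero_of_sepVal_eq hx
  obtain ⟨⟨_, σ, rfl⟩, hg⟩ := IsCyclic.exists_generator (α := (tameCharacterHom hn).range)
  refine ⟨σ, Nat.dvd_antisymm ?_ ?_⟩
  · rw [orderOf_dvd_iff_pow_eq_one]
    exact Subtype.ext ((mem_rootsOfUnity n _).1 (Subtype.property _))
  set m := orderOf (tameCharacter K n σ) with hm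
  have hfix : ∀ τ ∈ inertia K, τ (x ^ m) = x ^ m := by
    intro τ hτ
    have h1 : tameCharacter K n ⟨τ, hτ⟩ ^ m = 1 := by
      obtain ⟨k, hk⟩ := hg ⟨tameCharacterHom hn ⟨τ, hτ⟩, ⟨τ, hτ⟩, rfl⟩
      have hk' : tameCharacter K n σ ^ k = tameCharacter K n ⟨τ, hτ⟩ := congrArg Subtype.val hk
      rw [← hk', ← zpow_natCast, ← zpow_mul, mul_comm, zpow_mul, zpow_natCast, hm,
        pow_orderOf_eq_one, one_zpow]
    have h2 : (((tameCharacter K n ⟨τ, hτ⟩ : (SeparableClosure K)ˣ)) : SeparableClosure K)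
        = τ x / x := by
      refine eq_of_res_eq_of_pow_eq_one hn (coe_rootsOfUnity_pow_eq_one _)
        (galois_div_pow_eq_one hx0 ha τ) ?_
      exact res_tameCharacter hn ⟨τ, hτ⟩ hx
    have h3 : (τ x / x) ^ m = 1 := by
      rw [← h2]
      rw [← Units.val_pow_eq_pow_val, ← Subgroup.coe_pow, h1, Subgroup.coe_one, Units.val_one]
    rw [div_pow, div_eq_one_iff_eq (pow_ne_zero _ hx0)] at h3
    rw [map_pow, h3]
  obtain ⟨k, hk⟩ := sepVal_int_of_fixed_inertia (pow_ne_zero m hx0) hfix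
  rw [sepVal_pow_eq hx] at hk
  replace hk := WithTop.coe_injective hk
  have hnR : (n : ℝ) ≠ 0 := by exact_mod_cast hn0
  have h4 : (m : ℤ) = n * k := by
    have : (m : ℝ) = n * k := by
      rw [← hk]
      field_simp
    exact_mod_cast this
  exact Int.natCast_dvd_natCast.1 ⟨k, h4⟩

end Tame

/-! ### The wild inertia group -/

section Wild

variable {K : Type*} [Field K] [ValuativeRel K] [TopologicalSpace K] [IsNonarchimedeanLocalField K]

theorem galois_mem {K : Type*} [Field K] (L : FiniteGaloisIntermediateField K (SeparableClosure K))
    (σ : Gal(SeparableClosure K/K)) {x : SeparableClosure K} (hx : x ∈ L.toIntermediateField) :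
    σ x ∈ L.toIntermediateField := by
  have h : ((AlgEquiv.restrictNormalHom L σ ⟨x, hx⟩ : L) : SeparableClosure K) = σ x :=
    AlgEquiv.restrictNormal_commutes σ L ⟨x, hx⟩
  rw [← h]
  exact Subtype.property _

/-- The lower ramification groups in terms of the valuation of the separable closure. -/
theorem mem_comap_lowerRamification_iff
    (L : FiniteGaloisIntermediateField K (SeparableClosure K)) (u : ℝ)
    (σ : Gal(SeparableClosure K/K)) :
    AlgEquiv.restrictNormalHom L σ ∈ lowerRamification K L u ↔
      ∀ x ∈ L.toIntermediateField, 0 ≤ sepVal K x →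
        (((u + 1) / ramificationIndex K L.toIntermediateField : ℝ) : WithTop ℝ) ≤
          sepVal K (σ x - x) := by
  have he : (0 : ℝ) < ramificationIndex K L.toIntermediateField := by
    exact_mod_cast (valueGroup_eq L.toIntermediateField).1
  have key : ∀ (c : ℝ) (s : WithTop ℝ),
      (c : WithTop ℝ) ≤ s.map (fun r : ℝ => (ramificationIndex K L.toIntermediateField : ℝ) * r) ↔
        ((c / ramificationIndex K L.toIntermediateField : ℝ) : WithTop ℝ) ≤ s := by
    intro c s
    induction s using WithTop.recTopCoe with
    | top => simp
    | coe s =>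
      rw [WithTop.map_coe, WithTop.coe_le_coe, WithTop.coe_le_coe, div_le_iff₀' he]
  have h (x : L) : ((AlgEquiv.restrictNormalHom L σ x : L) : SeparableClosure K) = σ x :=
    AlgEquiv.restrictNormal_commutes σ L x
  constructor
  · intro hσ x hx hx0
    have h1 := hσ ⟨x, hx⟩ ((key 0 _).2 (by simpa using hx0))
    rw [fieldVal, key] at h1
    simpa [h] using h1
  · intro hσ x hx0
    rw [fieldVal, key]
    have h1 := hσ x x.2 (by simpa using (key 0 _).1 hx0)
    simpa [h] using h1

theorem mem_inertia_of_twist {σ : Gal(SeparableClosure K/K)}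
    (h : ∀ x : SeparableClosure K, x ≠ 0 → twist σ x = 1) : σ ∈ inertia K := by
  intro x hx
  by_cases hx0 : x = 0
  · simp [hx0]
  · exact hx.trans_lt ((twist_eq_one_iff σ hx0).1 (h x hx0))

/-- The values of a finite extension lie in `(1/e)ℤ`. -/
theorem le_sepVal_of_lt {L : IntermediateField K (SeparableClosure K)} [FiniteDimensional K L]
    {z : SeparableClosure K} (hz : z ∈ L) (k : ℤ)
    (h : ((k / (ramificationIndex K L : ℝ) : ℝ) : WithTop ℝ) < sepVal K z) :
    (((k + 1) / (ramificationIndex K L : ℝ) : ℝ) : WithTop ℝ) ≤ sepVal K z := by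
  by_cases hz0 : z = 0
  · simp [hz0]
  obtain ⟨m, hm⟩ := exists_sepVal_eq_div L hz hz0
  have he : (0 : ℝ) < ramificationIndex K L := by exact_mod_cast (valueGroup_eq L).1
  rw [hm, WithTop.coe_lt_coe, div_lt_div_iff_of_pos_right he] at h
  rw [hm, WithTop.coe_le_coe, div_le_div_iff_of_pos_right he]
  exact_mod_cast h

/-- Triviality of the twist on a finite extension can be tested on a uniformizer. -/
theorem twist_eq_one_of_uniformizer {L : IntermediateField K (SeparableClosure K)}
    [FiniteDimensional K L] {σ : Gal(SeparableClosure K/K)} (hI : σ ∈ inertia K)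
    {π : SeparableClosure K}
    (hπ : sepVal K π = ((1 / (ramificationIndex K L : ℝ) : ℝ) : WithTop ℝ))
    (h1 : twist σ π = 1) {x : SeparableClosure K} (hx : x ∈ L) (hx0 : x ≠ 0) : twist σ x = 1 := by
  have hπ0 := ne_zero_of_sepVal_eq hπ
  have hpow (k : ℕ) : twist σ (π ^ k) = 1 := by rw [twist_pow σ hπ0, h1, one_pow]
  -- Up to a unit, on which inertia has trivial twist, `x` is a power of `π`.
  obtain ⟨m, hm⟩ := exists_sepVal_eq_div L hx hx0
  rcases Int.eq_nat_or_neg m with ⟨k, rfl | rfl⟩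
  · rw [twist_congr hI hx0 (y := π ^ k), hpow]
    rw [hm, sepVal_pow_eq hπ]
    congr 1
    push_cast
    ring
  · have h2 : sepVal K (x * π ^ k) = 0 := by
      rw [AddValuation.map_mul, hm, sepVal_pow_eq hπ, ← WithTop.coe_add, ← WithTop.coe_zero]
      congr 1
      push_cast
      ring
    have h3 := twist_eq_one_of_sepVal_eq_zero hI h2
    rwa [twist_mul σ hx0 (pow_ne_zero _ hπ0), hpow, mul_one] at h3

theorem twist_eq_one_of_mem_wildInertia {σ : Gal(SeparableClosure K/K)} (hσ : σ ∈ wildInertia K) :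
    ∀ x : SeparableClosure K, x ≠ 0 → twist σ x = 1 := by
  have key : ∀ (L : FiniteGaloisIntermediateField K (SeparableClosure K)),
      ∀ x ∈ L.toIntermediateField, 0 ≤ sepVal K x →
        (((1 + 1) / ramificationIndex K L.toIntermediateField : ℝ) : WithTop ℝ) ≤
          sepVal K (σ x - x) := fun L =>
    (mem_comap_lowerRamification_iff L 1 σ).1 (Subgroup.mem_iInf.1 hσ L)
  have hmem (x : SeparableClosure K) : x ∈ (FiniteGaloisIntermediateField.adjoin K
      ({x} : Set (SeparableClosure K))).toIntermediateField :=
    FiniteGaloisIntermediateField.subset_adjoin K {x} rfl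
  have he (L : FiniteGaloisIntermediateField K (SeparableClosure K)) :
      (0 : ℝ) < ramificationIndex K L.toIntermediateField := by
    exact_mod_cast (valueGroup_eq L.toIntermediateField).1
  have hI : σ ∈ inertia K := fun x hx => by
    refine lt_of_lt_of_le ?_ (key _ x (hmem x) hx)
    have := he (FiniteGaloisIntermediateField.adjoin K ({x} : Set (SeparableClosure K)))
    exact WithTop.coe_pos.2 (by positivity)
  intro x hx0
  set L := FiniteGaloisIntermediateField.adjoin K ({x} : Set (SeparableClosure K)) with hL
  obtain ⟨π, hπL, hπ⟩ := exists_sepVal_eq_inv_ramificationIndex L.toIntermediateField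
  have hπ0 := ne_zero_of_sepVal_eq hπ
  have hLpos := he L
  have h1 : twist σ π = 1 := by
    rw [twist_eq_one_iff σ hπ0, hπ]
    refine lt_of_lt_of_le ?_ (key L π hπL (hπ ▸ WithTop.coe_nonneg.2 (by positivity)))
    rw [WithTop.coe_lt_coe, div_lt_div_iff_of_pos_right hLpos]
    norm_num
  exact twist_eq_one_of_uniformizer hI hπ h1 (hmem x) hx0

/-- The converse of `twist_eq_one_of_mem_wildInertia`. The twist only controls `σ x - x` relative to
the valuation of `x`, so the units of a finite extension need an extra argument. -/
theorem mem_wildInertia_of_twist {σ : Gal(SeparableClosure K/K)}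
    (h : ∀ x : SeparableClosure K, x ≠ 0 → twist σ x = 1) : σ ∈ wildInertia K := by
  have hI := mem_inertia_of_twist h
  refine Subgroup.mem_iInf.2 fun L => (mem_comap_lowerRamification_iff L 1 σ).2 fun x hx hx0 => ?_
  have hsub {z : SeparableClosure K} (hz : z ∈ L.toIntermediateField) :
      σ z - z ∈ L.toIntermediateField := sub_mem (galois_mem L σ hz) hz
  have hone {z : SeparableClosure K} (hz : z ∈ L.toIntermediateField) (h : 0 < sepVal K z) :
      ((1 / ramificationIndex K L.toIntermediateField : ℝ) : WithTop ℝ) ≤ sepVal K z := by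
    have := le_sepVal_of_lt hz 0 (by simpa using h)
    simpa using this
  have htwo {z : SeparableClosure K} (hz : z ∈ L.toIntermediateField) (h0 : 0 < sepVal K z) :
      (((1 + 1) / ramificationIndex K L.toIntermediateField : ℝ) : WithTop ℝ) ≤
        sepVal K (σ z - z) := by
    by_cases hz0 : z = 0
    · simp [hz0]
    have := le_sepVal_of_lt (hsub hz) 1 (by
      simpa using (hone hz h0).trans_lt ((twist_eq_one_iff σ hz0).1 (h z hz0)))
    simpa using this
  rcases hx0.eq_or_lt with h0 | h0
  · -- A unit `x` satisfies `x ≡ x ^ Q` modulo the maximal ideal for a power `Q` of the residue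
    -- characteristic, and `σ (x ^ Q) - x ^ Q` is divisible by `(σ x - x) * Q` up to higher terms.
    obtain ⟨n, hn, hxn⟩ := exists_pow_res_eq_one h0.symm
    set Q := ringChar 𝓀[K] ^ n.totient with hQ
    have hp : (ringChar 𝓀[K]).Prime := residueChar_prime
    have hQ0 : 1 ≤ Q := Nat.one_le_pow _ _ hp.pos
    have hdvd : n ∣ Q - 1 :=
      (Nat.modEq_iff_dvd' hQ0).1 (Nat.ModEq.pow_totient hn.symm).symm
    have hQres : (Q : SepResidue K) = 0 := by
      rw [CharP.cast_eq_zero_iff (SepResidue K) (ringChar 𝓀[K]), hQ]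
      exact dvd_pow_self _ (Nat.totient_pos.2 (Nat.pos_of_ne_zero (ne_zero_of_coprime hn))).ne'
    have hy : 0 < sepVal K (x ^ Q - x) := by
      obtain ⟨k, hk⟩ := hdvd
      rw [← res_eq_iff (sepVal_pow_nonneg hx0 Q) hx0, res_pow hx0]
      conv_lhs => rw [← Nat.sub_add_cancel hQ0, pow_succ, hk, pow_mul, hxn, one_pow, one_mul]
    have hσx : 0 ≤ sepVal K (σ x) := by rwa [sepVal_galois]
    have hgeom := (Commute.all (σ x) x).geom_sum₂_mul Q
    have h1 : 0 < sepVal K (∑ i ∈ Finset.range Q, (σ x) ^ i * x ^ (Q - 1 - i)) := by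
      rw [← res_eq_zero_iff (sepVal_geom_sum₂_nonneg hσx hx0 Q),
        res_geom_sum₂ hσx hx0 (res_galois hI hx0), hQres, zero_mul]
    have h2 : (∑ i ∈ Finset.range Q, (σ x) ^ i * x ^ (Q - 1 - i)) ∈ L.toIntermediateField :=
      sum_mem fun i _ => mul_mem (pow_mem (galois_mem L σ hx) _) (pow_mem hx _)
    have h3 : σ x - x = (∑ i ∈ Finset.range Q, (σ x) ^ i * x ^ (Q - 1 - i)) * (σ x - x) -
        (σ (x ^ Q - x) - (x ^ Q - x)) := by
      rw [hgeom, map_sub, map_pow]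
      ring
    rw [h3]
    refine (sepVal K).map_le_sub ?_ (htwo (sub_mem (pow_mem hx _) hx) hy)
    rw [AddValuation.map_mul, add_div, WithTop.coe_add]
    exact add_le_add (hone h2 h1) (hone (hsub hx) (hI x hx0))
  · exact htwo hx h0

/-- The wild inertia group consists of the `σ` with `σ(x)/x ≡ 1` for all `x ≠ 0`. -/
theorem mem_wildInertia_iff {σ : Gal(SeparableClosure K/K)} :
    σ ∈ wildInertia K ↔ ∀ x : SeparableClosure K, x ≠ 0 → twist σ x = 1 :=
  ⟨twist_eq_one_of_mem_wildInertia, mem_wildInertia_of_twist⟩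

theorem wildInertia_le_inertia : wildInertia K ≤ inertia K := fun _ hσ =>
  mem_inertia_of_twist (mem_wildInertia_iff.1 hσ)

/-- An element of prime-to-`p` order that acts wildly acts trivially: the trace over the powers of
`s` is injective on wildly acted elements and kills every `s x - x`. -/
theorem galois_eq_of_wild_of_pow {L : IntermediateField K (SeparableClosure K)}
    {s : Gal(SeparableClosure K/K)} (hs : s ∈ inertia K) (hL : ∀ x ∈ L, s x ∈ L)
    (hw : ∀ x ∈ L, x ≠ 0 → twist s x = 1) {m : ℕ} (hm : m.Coprime (ringChar 𝓀[K]))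
    (hfix : ∀ x ∈ L, (s ^ m) x = x) : ∀ x ∈ L, s x = x := by
  intro x hx
  by_contra hne
  have hy0 : s x - x ≠ 0 := sub_ne_zero.2 hne
  have hy : s x - x ∈ L := sub_mem (hL x hx) hx
  have hsum : ∑ i ∈ Finset.range m, (s ^ i) (s x - x) = 0 := by
    have : ∀ i, (s ^ i) (s x - x) = (s ^ (i + 1)) x - (s ^ i) x := fun i => by
      rw [map_sub, pow_succ, AlgEquiv.mul_apply]
    simp_rw [this]
    rw [Finset.sum_range_sub (fun i => (s ^ i) x), hfix x hx]
    simp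
  have hres : res (∑ i ∈ Finset.range m, (s ^ i) (s x - x) / (s x - x)) = (m : SepResidue K) := by
    rw [res_sum _ _ fun i _ => (sepVal_galois_div _ hy0).ge]
    have : ∀ i ∈ Finset.range m, res ((s ^ i) (s x - x) / (s x - x)) = 1 := fun i _ => by
      have := twist_galois_pow hs hy0 i
      rwa [hw _ hy hy0, one_pow] at this
    rw [Finset.sum_congr rfl this]
    simp
  rw [← Finset.sum_div, hsum, zero_div, (res_eq_zero_iff (by simp)).2 (by simp)] at hres
  exact natCast_sepResidue_ne_zero hm hres.symm

end Wild

/-! ### The tame quotient of the inertia group of a finite quotient -/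

section TameQuotient

variable {K : Type*} [Field K] [ValuativeRel K] [TopologicalSpace K] [IsNonarchimedeanLocalField K]
variable {G : Type*} [Group G] [TopologicalSpace G] [DiscreteTopology G]

/-- The finite Galois extension cut out by `f`. -/
theorem exists_kernelField {K : Type*} [Field K] (f : Gal(SeparableClosure K/K) →ₜ* G) :
    ∃ L : IntermediateField K (SeparableClosure K), FiniteDimensional K L ∧
      (∀ x, x ∈ L ↔ ∀ σ, f σ = 1 → σ x = x) ∧ ∀ σ, (∀ x ∈ L, σ x = x) → f σ = 1 := by
  have hopen : IsOpen ((f : Gal(SeparableClosure K/K) →* G).ker : Set Gal(SeparableClosure K/K)) :=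
    (isOpen_discrete ({1} : Set G)).preimage f.continuous_toFun
  let H : ClosedSubgroup Gal(SeparableClosure K/K) :=
    ⟨(f : Gal(SeparableClosure K/K) →* G).ker, Subgroup.isClosed_of_isOpen _ hopen⟩
  have hH := InfiniteGalois.fixingSubgroup_fixedField H
  refine ⟨IntermediateField.fixedField H.1, ?_, fun x => ?_, fun σ hσ => ?_⟩
  · rw [← InfiniteGalois.isOpen_iff_finite]
    change IsOpen ((IntermediateField.fixedField H.1).fixingSubgroup :
      Set Gal(SeparableClosure K/K))
    rw [hH]
    exact hopen
  · exact ⟨fun h σ hσ => h ⟨σ, hσ⟩, fun h σ => h σ.1 σ.2⟩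
  · have : σ ∈ (IntermediateField.fixedField H.1).fixingSubgroup := fun x => hσ x x.2
    rw [hH] at this
    exact this

open Topology in
theorem setOf_apply_eq_mem_nhds {K : Type*} [Field K] (τ : Gal(SeparableClosure K/K))
    (x : SeparableClosure K) : {ρ : Gal(SeparableClosure K/K) | ρ x = τ x} ∈ 𝓝 τ := by
  have := IntermediateField.adjoin.finiteDimensional
    (Algebra.IsIntegral.isIntegral (R := K) x)
  have ho := (IntermediateField.adjoin K {x}).fixingSubgroup_isOpen.preimage
    (continuous_const_mul τ⁻¹)
  refine Filter.mem_of_superset (ho.mem_nhds (x := τ) (by simp)) fun ρ hρ => ?_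
  have h : (τ⁻¹ * ρ) x = x := hρ ⟨x, IntermediateField.mem_adjoin_simple_self K x⟩
  have h' : (τ * (τ⁻¹ * ρ)) x = τ x := by rw [AlgEquiv.mul_apply, h]
  rwa [mul_inv_cancel_left] at h'

/-- Exponents that tend to `1` modulo powers of `p` and to `0` modulo numbers prime to `p`. -/
theorem exists_projection_exponents {p : ℕ} (hp : p.Prime) :
    ∃ N : ℕ → ℕ, (∀ k, N k ≡ 1 [MOD p ^ k]) ∧ ∀ n : ℕ, n.Coprime p → ∀ k, n ≤ k → n ∣ N k := by
  refine ⟨fun k => (∏ i ∈ (Finset.range (k + 1)).filter (·.Coprime p), i) ^ (p ^ k).totient,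
    fun k => Nat.ModEq.pow_totient ?_, fun n hn k hk => ?_⟩
  · exact Nat.Coprime.pow_right _ (Nat.Coprime.prod_left fun i hi => (Finset.mem_filter.1 hi).2)
  · refine (Finset.dvd_prod_of_mem (fun i => i) (a := n) ?_).trans (dvd_pow_self _ ?_)
    · exact Finset.mem_filter.2 ⟨Finset.mem_range.2 (Nat.lt_succ_of_le hk), hn⟩
    · exact (Nat.totient_pos.2 (pow_pos hp.pos k)).ne'

open Filter Topology in
/-- An element of the inertia group acting wildly on the extension cut out by `f` has the same image
under `f` as some element of the wild inertia group, namely its `p`-primary part. -/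
theorem exists_mem_wildInertia_map_eq [Finite G] (f : Gal(SeparableClosure K/K) →ₜ* G)
    {L : IntermediateField K (SeparableClosure K)} (hL : ∀ x, x ∈ L ↔ ∀ σ, f σ = 1 → σ x = x)
    (hL' : ∀ σ, (∀ x ∈ L, σ x = x) → f σ = 1) {σ : Gal(SeparableClosure K/K)}
    (hσ : σ ∈ inertia K) (hw : ∀ x ∈ L, x ≠ 0 → twist σ x = 1) :
    ∃ τ ∈ wildInertia K, f τ = f σ := by
  have hp : (ringChar 𝓀[K]).Prime := residueChar_prime
  have hstab : ∀ (τ : Gal(SeparableClosure K/K)), ∀ x ∈ L, τ x ∈ L := by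
    intro τ x hx
    rw [hL]
    intro ρ hρ
    have h1 : (τ⁻¹ * ρ * τ) x = x := (hL x).1 hx _ (by simp [hρ])
    have h2 : (τ * (τ⁻¹ * ρ * τ)) x = (ρ * τ) x := by congr 1; group
    rw [AlgEquiv.mul_apply, h1] at h2
    exact h2.symm
  -- The order of `f σ` is a power of `p`: its prime-to-`p` part acts wildly, hence trivially.
  obtain ⟨a, m, hm, ham⟩ := Nat.exists_eq_pow_mul_and_not_dvd (orderOf_pos (f σ)).ne'
    (ringChar 𝓀[K]) hp.ne_one
  have hm' : m.Coprime (ringChar 𝓀[K]) := ((Nat.Prime.coprime_iff_not_dvd hp).2 hm).symm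
  have hpa : f σ ^ (ringChar 𝓀[K] ^ a) = 1 := by
    rw [← map_pow]
    refine hL' _ (galois_eq_of_wild_of_pow (pow_mem hσ _) (hstab _) (fun x hx hx0 => ?_) hm'
      fun x hx => (hL x).1 hx _ ?_)
    · rw [twist_galois_pow hσ hx0, hw x hx hx0, one_pow]
    · rw [map_pow, map_pow, ← pow_mul, ← ham, pow_orderOf_eq_one]
  -- A cluster point `τ` of the powers `σ ^ N k` has trivial twist, as twists are roots of unity of
  -- order prime to `p`, while `f τ = f σ`.
  obtain ⟨N, hN1, hN0⟩ := exists_projection_exponents hp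
  obtain ⟨τ, -, hτ⟩ := isCompact_univ (X := Gal(SeparableClosure K/K)).exists_mapClusterPt
    (f := atTop (α := ℕ)) (u := fun k => σ ^ N k) (by simp)
  rw [mapClusterPt_iff_frequently] at hτ
  refine ⟨τ, mem_wildInertia_iff.2 fun x hx => ?_, ?_⟩
  · obtain ⟨n, hn, h1⟩ := exists_pow_res_eq_one (sepVal_galois_div σ hx)
    have hU : {ρ : Gal(SeparableClosure K/K) | ρ x = τ x} ∈ 𝓝 τ := setOf_apply_eq_mem_nhds τ x
    obtain ⟨k, hk, hkn⟩ := ((hτ _ hU).and_eventually (eventually_ge_atTop n)).exists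
    have h2 : twist τ x = twist (σ ^ N k) x := by
      rw [twist, twist, show (σ ^ N k) x = τ x from hk]
    obtain ⟨j, hj⟩ := hN0 n hn k hkn
    rw [h2, twist_galois_pow hσ hx, hj, pow_mul, twist, h1, one_pow]
  · have hU : {ρ : Gal(SeparableClosure K/K) | f ρ = f τ} ∈ 𝓝 τ :=
      f.continuous_toFun.continuousAt (mem_nhds_discrete.2 (Set.mem_singleton (f τ)))
    obtain ⟨k, hk, hka⟩ := ((hτ _ hU).and_eventually (eventually_ge_atTop a)).exists
    have h2 : f τ = f σ ^ N k := by rw [← map_pow]; exact hk.symm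
    have h3 : N k ≡ 1 [MOD orderOf (f σ)] :=
      (hN1 k).of_dvd ((orderOf_dvd_of_pow_eq_one hpa).trans (pow_dvd_pow _ hka))
    rw [h2, pow_eq_pow_iff_modEq.2 h3, pow_one]

variable (K) in
theorem shiftedRamification_one : shiftedRamification K 1 = wildInertia K := by
  simp [shiftedRamification]

/-- The structure of the tame quotient: `e₀(f)` is prime to the residue characteristic, and
`γ_{e₀(f)}` induces an isomorphism of `f(I)/f(I^1)` onto the group of roots of unity. It is the
prime-to-`p` part of the ramification index of the extension cut out by `f`. -/
theorem tameIndex_spec [Finite G] (f : Gal(SeparableClosure K/K) →ₜ* G) :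
    (tameIndex f).Coprime (ringChar 𝓀[K]) ∧ ∀ σ : inertia K,
      f σ ∈ (wildInertia K).map (f : Gal(SeparableClosure K/K) →* G) ↔
        tameCharacter K (tameIndex f) σ = 1 := by
  have hp : (ringChar 𝓀[K]).Prime := residueChar_prime
  obtain ⟨L, hfin, hL, hL'⟩ := exists_kernelField f
  have hepos := (valueGroup_eq L).1
  obtain ⟨π, hπL, hπ⟩ := exists_sepVal_eq_inv_ramificationIndex L
  obtain ⟨a, n, hn, han⟩ := Nat.exists_eq_pow_mul_and_not_dvd hepos.ne' (ringChar 𝓀[K]) hp.ne_one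
  have hcop : n.Coprime (ringChar 𝓀[K]) := ((Nat.Prime.coprime_iff_not_dvd hp).2 hn).symm
  have hn0 : (n : ℝ) ≠ 0 := by exact_mod_cast ne_zero_of_coprime hcop
  have hp0 : (ringChar 𝓀[K] : ℝ) ≠ 0 := by exact_mod_cast hp.ne_zero
  have hπ0 := ne_zero_of_sepVal_eq hπ
  have hπn : sepVal K (π ^ (ringChar 𝓀[K] ^ a)) = ((1 / n : ℝ) : WithTop ℝ) := by
    rw [sepVal_pow_eq hπ, han]
    congr 1
    push_cast
    field_simp
  have hmem : π ^ (ringChar 𝓀[K] ^ a) ∈ L := pow_mem hπL _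
  -- First the equivalence for the prime-to-`p` part `n` of the ramification index.
  have key : ∀ σ : inertia K, f σ ∈ (wildInertia K).map (f : Gal(SeparableClosure K/K) →* G) ↔
      tameCharacter K n σ = 1 := by
    intro σ
    rw [tameCharacter_eq_one_iff hcop σ hπn]
    constructor
    · rintro ⟨τ, hτ, hτσ⟩
      replace hτσ : f τ = f σ := hτσ
      have h1 : (τ⁻¹ * (σ : Gal(SeparableClosure K/K))) (π ^ (ringChar 𝓀[K] ^ a)) =
          π ^ (ringChar 𝓀[K] ^ a) := (hL _).1 hmem _ (by simp [hτσ])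
      have h2 : (σ : Gal(SeparableClosure K/K)) (π ^ (ringChar 𝓀[K] ^ a)) =
          τ (π ^ (ringChar 𝓀[K] ^ a)) := by
        conv_rhs => rw [← h1, ← AlgEquiv.mul_apply, mul_inv_cancel_left]
      rw [twist, h2]
      exact mem_wildInertia_iff.1 hτ _ (pow_ne_zero _ hπ0)
    · intro h
      -- The residue field has no nontrivial `p`-power roots of unity.
      have hπ1 : twist (σ : Gal(SeparableClosure K/K)) π = 1 := by
        rw [twist_pow _ hπ0] at h
        have : ExpChar (SepResidue K) (ringChar 𝓀[K]) := ExpChar.prime hp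
        have h1 := (ExpChar.pow_prime_pow_mul_eq_one_iff (ringChar 𝓀[K]) a 1
          (twist (σ : Gal(SeparableClosure K/K)) π)).1 (by rwa [mul_one])
        rwa [pow_one] at h1
      have hw : ∀ x ∈ L, x ≠ 0 → twist (σ : Gal(SeparableClosure K/K)) x = 1 := fun x hx hx0 =>
        twist_eq_one_of_uniformizer σ.2 hπ hπ1 hx hx0
      obtain ⟨τ, hτ, hτσ⟩ := exists_mem_wildInertia_map_eq f hL hL' σ.2 hw
      exact ⟨τ, hτ, hτσ⟩
  -- Then `n` is the order of the tame quotient, as `γ_n` is surjective.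
  have hidx : tameIndex f = n := by
    have hker : (((wildInertia K).map (f : Gal(SeparableClosure K/K) →* G)).comap
        (f : Gal(SeparableClosure K/K) →* G)).subgroupOf (inertia K) =
        (tameCharacterHom hcop).ker := by
      ext σ
      exact key σ
    have : NeZero n := ⟨ne_zero_of_coprime hcop⟩
    have : NeZero (n : SeparableClosure K) := ⟨natCast_sep_ne_zero hcop⟩
    rw [tameIndex, shiftedRamification_one, inertiaImage, ← Subgroup.relIndex_comap,
      Subgroup.relIndex, hker, Subgroup.index_ker]
    refine Nat.dvd_antisymm ?_ ?_
    · exact (Subgroup.card_subgroup_dvd_card _).trans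
        (HasEnoughRootsOfUnity.natCard_rootsOfUnity (SeparableClosure K) n).dvd
    · obtain ⟨σ, hσ⟩ := exists_orderOf_tameCharacter_eq hcop
      exact hσ.symm.dvd.trans (Subgroup.orderOf_dvd_natCard _ ⟨σ, rfl⟩)
  rw [hidx]
  exact ⟨hcop, key⟩

end TameQuotient

/-! ### Multiplicities of one-dimensional characters -/

section Multiplicity

variable {E : Type*} [Field E] {G : Type*} [Group G]
variable {V W : Type*} [AddCommGroup V] [Module E V] [AddCommGroup W] [Module E W]

/-- The `χ`-isotypic subspace of the restriction of `ρ` to `H`. -/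
def isotypic (ρ : Representation E G V) (H : Subgroup G) (χ : H →* Eˣ) : Submodule E V where
  carrier := {v | ∀ h : H, ρ h v = (χ h : E) • v}
  add_mem' hv hw h := by rw [map_add, hv h, hw h, smul_add]
  zero_mem' h := by rw [map_zero, smul_zero]
  smul_mem' c v hv h := by rw [map_smul, hv h, smul_comm]

theorem mem_isotypic {ρ : Representation E G V} {H : Subgroup G} {χ : H →* Eˣ} {v : V} :
    v ∈ isotypic ρ H χ ↔ ∀ h : H, ρ h v = (χ h : E) • v := Iff.rfl

/-- An equivariant map out of `χ` is determined by the image of `1`, an arbitrary vector of the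
isotypic subspace. -/
theorem pairing_ofCharacter (ρ : Representation E G V) (H : Subgroup G) (χ : H →* Eˣ) :
    pairing (ρ.comp H.subtype) (ofCharacter χ) = Module.finrank E (isotypic ρ H χ) := by
  have h2 (h : H) : ofCharacter χ h 1 = (χ h : E) • (1 : E) := rfl
  refine LinearEquiv.finrank_eq (R := E)
    { toFun := fun φ => ⟨φ 1, fun h => ?_⟩
      map_add' := fun φ ψ => rfl
      map_smul' := fun c φ => rfl
      invFun := fun v => ⟨LinearMap.toSpanSingleton _ _ (v : V), fun h => ?_⟩
      left_inv := fun φ => ?_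
      right_inv := fun v => ?_ }
  · have h1 := LinearMap.congr_fun (φ.isIntertwining' h) 1
    rw [LinearMap.comp_apply, h2, map_smul] at h1
    exact h1.symm
  · refine LinearMap.ext_ring ?_
    rw [LinearMap.comp_apply, h2, map_smul, LinearMap.comp_apply,
      LinearMap.toSpanSingleton_apply, one_smul]
    exact (v.2 h).symm
  · ext
    simp
  · ext
    simp

theorem finrank_isotypic_one_mono [FiniteDimensional E V] (ρ : Representation E G V)
    {H₁ H₂ : Subgroup G} (h : H₁ ≤ H₂) :
    Module.finrank E (isotypic ρ H₂ 1) ≤ Module.finrank E (isotypic ρ H₁ 1) :=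
  Submodule.finrank_mono fun _ hv g => hv ⟨g, h g.2⟩

theorem isotypic_eq_top (ρ : Representation E G V) {H : Subgroup G} (h : ∀ g ∈ H, g = 1) :
    isotypic ρ H 1 = ⊤ := by
  refine eq_top_iff.2 fun v _ => mem_isotypic.2 fun g => ?_
  rw [h g g.2, map_one]
  simp

theorem isotypic_eq_bot (ρ : Representation E G V) {H : Subgroup G} {χ : H →* Eˣ} (h : H)
    (hρ : ρ h = 1) (hχ : χ h ≠ 1) : isotypic ρ H χ = ⊥ := by
  refine eq_bot_iff.2 fun v hv => (Submodule.mem_bot _).2 ?_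
  have h1 := hv h
  rw [hρ, Module.End.one_apply] at h1
  have h2 : ((χ h : E) - 1) • v = 0 := by rw [sub_smul, one_smul, ← h1, sub_self]
  exact (smul_eq_zero.1 h2).resolve_left fun h3 => hχ (Units.ext (sub_eq_zero.1 h3))

theorem isotypic_comp {G' : Type*} [Group G'] (φ : G →* G') (ρ : Representation E G' V)
    {H : Subgroup G} {H' : Subgroup G'} {χ : H →* Eˣ} {χ' : H' →* Eˣ}
    (h₁ : ∀ h (hh : h ∈ H), ∃ hh' : φ h ∈ H', χ' ⟨φ h, hh'⟩ = χ ⟨h, hh⟩)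
    (h₂ : ∀ g ∈ H', ∃ h ∈ H, φ h = g) : isotypic ρ H' χ' = isotypic (ρ.comp φ) H χ := by
  ext v
  constructor
  · rintro hv ⟨h, hh⟩
    obtain ⟨hh', hχ⟩ := h₁ h hh
    rw [← hχ]
    exact hv ⟨φ h, hh'⟩
  · rintro hv ⟨g, hg⟩
    obtain ⟨h, hh, rfl⟩ := h₂ g hg
    obtain ⟨hh', hχ⟩ := h₁ h hh
    rw [hχ]
    exact hv ⟨h, hh⟩

theorem finrank_isotypic_congr {ρ : Representation E G V} {τ : Representation E G W}
    (e : V ≃ₗ[E] W) (he : ∀ g v, e (ρ g v) = τ g (e v)) (H : Subgroup G) (χ : H →* Eˣ) :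
    Module.finrank E (isotypic ρ H χ) = Module.finrank E (isotypic τ H χ) := by
  have : (isotypic ρ H χ).map (e : V →ₗ[E] W) = isotypic τ H χ := by
    ext w
    constructor
    · rintro ⟨v, hv, rfl⟩ h
      rw [LinearEquiv.coe_coe, ← he, hv h, map_smul]
    · intro hw
      refine ⟨e.symm w, fun h => e.injective ?_, e.apply_symm_apply w⟩
      rw [he, map_smul, e.apply_symm_apply, hw h]
  rw [← this]
  exact (LinearEquiv.finrank_map_eq e _).symm

theorem finrank_isotypic_prod [FiniteDimensional E V] [FiniteDimensional E W]
    (ρ : Representation E G V) (τ : Representation E G W) (H : Subgroup G) (χ : H →* Eˣ) :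
    Module.finrank E (isotypic (ρ.prod τ) H χ) =
      Module.finrank E (isotypic ρ H χ) + Module.finrank E (isotypic τ H χ) := by
  have hmem : ∀ v, v ∈ isotypic (ρ.prod τ) H χ ↔ v.1 ∈ isotypic ρ H χ ∧ v.2 ∈ isotypic τ H χ := by
    intro v
    simp only [mem_isotypic, ← forall_and]
    exact forall_congr' fun h => Prod.ext_iff
  rw [← Module.finrank_prod]
  exact LinearEquiv.finrank_eq
    { toFun := fun v => (⟨v.1.1, ((hmem v).1 v.2).1⟩, ⟨v.1.2, ((hmem v).1 v.2).2⟩)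
      map_add' := fun v w => rfl
      map_smul' := fun c v => rfl
      invFun := fun w => ⟨(w.1, w.2), (hmem _).2 ⟨w.1.2, w.2.2⟩⟩
      left_inv := fun v => rfl
      right_inv := fun w => rfl }

end Multiplicity

section CharPairing

variable {K : Type*} [Field K] {G : Type*} [Group G]
variable {V W : Type*} [AddCommGroup V] [Module K V] [AddCommGroup W] [Module K W]

theorem extendScalars_tmul {E : Type*} [Field E] [Algebra K E] (ρ : Representation K G V) (g : G)
    (c : E) (v : V) : extendScalars E ρ g (c ⊗ₜ[K] v) = c ⊗ₜ[K] ρ g v := rfl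

theorem charPairing_eq_finrank_isotypic (ρ : Representation K G V) (H : Subgroup G)
    (χ : H →* (SeparableClosure K)ˣ) : charPairing ρ H χ =
      Module.finrank (SeparableClosure K) (isotypic (extendScalars (SeparableClosure K) ρ) H χ) :=
  pairing_ofCharacter (extendScalars (SeparableClosure K) ρ) H χ

theorem charPairing_one_mono [FiniteDimensional K V] (ρ : Representation K G V)
    {H₁ H₂ : Subgroup G} (h : H₁ ≤ H₂) : charPairing ρ H₂ 1 ≤ charPairing ρ H₁ 1 := by
  rw [charPairing_eq_finrank_isotypic, charPairing_eq_finrank_isotypic]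
  exact finrank_isotypic_one_mono _ h

theorem charPairing_le [FiniteDimensional K V] (ρ : Representation K G V) (H : Subgroup G)
    (χ : H →* (SeparableClosure K)ˣ) : charPairing ρ H χ ≤ Module.finrank K V := by
  rw [charPairing_eq_finrank_isotypic]
  exact (Submodule.finrank_le _).trans_eq Module.finrank_baseChange

theorem charPairing_one_of_forall_eq_one (ρ : Representation K G V) {H : Subgroup G}
    (h : ∀ g ∈ H, g = 1) : charPairing ρ H 1 = Module.finrank K V := by
  rw [charPairing_eq_finrank_isotypic, isotypic_eq_top _ h]
  exact (finrank_top _ _).trans Module.finrank_baseChange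

theorem charPairing_eq_zero (ρ : Representation K G V) {H : Subgroup G}
    {χ : H →* (SeparableClosure K)ˣ} (h : H) (hρ : ρ h = 1) (hχ : χ h ≠ 1) :
    charPairing ρ H χ = 0 := by
  rw [charPairing_eq_finrank_isotypic, isotypic_eq_bot _ h _ hχ]
  · exact finrank_bot _ _
  · change Module.End.baseChangeHom K (SeparableClosure K) V (ρ h) = 1
    rw [hρ, map_one]

theorem charPairing_comp {G' : Type*} [Group G'] (φ : G →* G') (ρ : Representation K G' V)
    {H : Subgroup G} {H' : Subgroup G'} {χ : H →* (SeparableClosure K)ˣ}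
    {χ' : H' →* (SeparableClosure K)ˣ}
    (h₁ : ∀ h (hh : h ∈ H), ∃ hh' : φ h ∈ H', χ' ⟨φ h, hh'⟩ = χ ⟨h, hh⟩)
    (h₂ : ∀ g ∈ H', ∃ h ∈ H, φ h = g) : charPairing ρ H' χ' = charPairing (ρ.comp φ) H χ := by
  rw [charPairing_eq_finrank_isotypic, charPairing_eq_finrank_isotypic, isotypic_comp φ _ h₁ h₂]
  rfl

theorem charPairing_congr {ρ : Representation K G V} {τ : Representation K G W} (e : V ≃ₗ[K] W)
    (he : ∀ g v, e (ρ g v) = τ g (e v)) (H : Subgroup G) (χ : H →* (SeparableClosure K)ˣ) :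
    charPairing ρ H χ = charPairing τ H χ := by
  rw [charPairing_eq_finrank_isotypic, charPairing_eq_finrank_isotypic]
  refine finrank_isotypic_congr (e.baseChange K (SeparableClosure K) V W) (fun g v => ?_) H χ
  induction v using TensorProduct.induction_on with
  | zero => simp
  | tmul x y => simp [extendScalars_tmul, he]
  | add x y hx hy => simp only [map_add, hx, hy]

theorem charPairing_prod [FiniteDimensional K V] [FiniteDimensional K W] (ρ : Representation K G V)
    (τ : Representation K G W) (H : Subgroup G) (χ : H →* (SeparableClosure K)ˣ) :
    charPairing (ρ.prod τ) H χ = charPairing ρ H χ + charPairing τ H χ := by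
  rw [charPairing_eq_finrank_isotypic, charPairing_eq_finrank_isotypic,
    charPairing_eq_finrank_isotypic, ← finrank_isotypic_prod]
  refine finrank_isotypic_congr
    (TensorProduct.prodRight K (SeparableClosure K) (SeparableClosure K) V W) (fun g v => ?_) H χ
  induction v using TensorProduct.induction_on with
  | zero => simp only [map_zero]
  | tmul x y => simp [extendScalars_tmul, Representation.prod]
  | add x y hx hy => simp only [map_add, hx, hy]

end CharPairing

/-! ### Integrability of the conductor integrand -/

section Herbrand

variable {K : Type*} [Field K] [ValuativeRel K] [TopologicalSpace K] [IsNonarchimedeanLocalField K]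
variable (L : FiniteGaloisIntermediateField K (SeparableClosure K))

theorem lowerRamification_antitone : Antitone (lowerRamification K L) := fun u u' h σ hσ x hx =>
  le_trans (WithTop.coe_le_coe.2 (by linarith)) (hσ x hx)

theorem relIndex_lowerRamification_pos (t : ℝ) :
    0 < (lowerRamification K L t).relIndex (lowerRamification K L 0) :=
  Nat.pos_of_ne_zero (Subgroup.index_ne_zero_of_finite
    (H := (lowerRamification K L t).subgroupOf (lowerRamification K L 0)))

theorem herbrand_integrand_antitone : Antitone fun t : ℝ =>
    (((lowerRamification K L t).relIndex (lowerRamification K L 0) : ℕ) : ℝ)⁻¹ := by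
  intro t t' h
  refine inv_anti₀ (by exact_mod_cast relIndex_lowerRamification_pos L t) ?_
  exact_mod_cast Subgroup.relIndex_le_of_le_left (lowerRamification_antitone L h)
    (relIndex_lowerRamification_pos L t').ne'

theorem herbrand_integrand_bounds (t : ℝ) :
    ((Nat.card (lowerRamification K L 0) : ℕ) : ℝ)⁻¹ ≤
      (((lowerRamification K L t).relIndex (lowerRamification K L 0) : ℕ) : ℝ)⁻¹ ∧
    (((lowerRamification K L t).relIndex (lowerRamification K L 0) : ℕ) : ℝ)⁻¹ ≤ 1 := by
  have hpos := relIndex_lowerRamification_pos L t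
  constructor
  · refine inv_anti₀ (by exact_mod_cast hpos) ?_
    exact_mod_cast Nat.le_of_dvd Nat.card_pos (Subgroup.relIndex_dvd_card _ _)
  · exact inv_le_one_of_one_le₀ (by exact_mod_cast hpos)

theorem herbrand_integrable (a b : ℝ) : IntervalIntegrable (fun t : ℝ =>
    (((lowerRamification K L t).relIndex (lowerRamification K L 0) : ℕ) : ℝ)⁻¹)
    MeasureTheory.volume a b :=
  (herbrand_integrand_antitone L).intervalIntegrable

theorem herbrand_sub (a b : ℝ) : herbrand K L b - herbrand K L a = ∫ t in a..b,
    (((lowerRamification K L t).relIndex (lowerRamification K L 0) : ℕ) : ℝ)⁻¹ :=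
  intervalIntegral.integral_interval_sub_left (herbrand_integrable L _ _)
    (herbrand_integrable L _ _)

theorem herbrand_growth {a b : ℝ} (h : a ≤ b) :
    (b - a) * ((Nat.card (lowerRamification K L 0) : ℕ) : ℝ)⁻¹ ≤ herbrand K L b - herbrand K L a ∧
      herbrand K L b - herbrand K L a ≤ b - a := by
  rw [herbrand_sub]
  constructor
  · have := intervalIntegral.integral_mono_on h
      (intervalIntegrable_const (c := ((Nat.card (lowerRamification K L 0) : ℕ) : ℝ)⁻¹)
        (μ := MeasureTheory.volume))
      (herbrand_integrable L a b) fun t _ => (herbrand_integrand_bounds L t).1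
    rwa [intervalIntegral.integral_const, smul_eq_mul] at this
  · have := intervalIntegral.integral_mono_on h (herbrand_integrable L a b)
      (intervalIntegrable_const (c := (1 : ℝ)) (μ := MeasureTheory.volume))
      fun t _ => (herbrand_integrand_bounds L t).2
    rwa [intervalIntegral.integral_const, smul_eq_mul, mul_one] at this

theorem herbrand_strictMono : StrictMono (herbrand K L) := by
  intro a b h
  have h1 := (herbrand_growth L h.le).1
  have h2 : 0 < (b - a) * ((Nat.card (lowerRamification K L 0) : ℕ) : ℝ)⁻¹ :=
    mul_pos (sub_pos.2 h) (inv_pos.2 (by exact_mod_cast Nat.card_pos))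
  linarith

theorem herbrand_zero : herbrand K L 0 = 0 := intervalIntegral.integral_same

theorem herbrand_continuous : Continuous (herbrand K L) :=
  intervalIntegral.continuous_primitive (fun a b => herbrand_integrable L a b) 0

/-- The Herbrand function attains every positive value at a point of `[-1, ∞)`. -/
theorem herbrand_invFunOn {s : ℝ} (hs : 0 < s) :
    herbrand K L (Function.invFunOn (herbrand K L) (Set.Ici (-1)) s) = s := by
  refine Function.invFunOn_eq ?_
  set c : ℝ := ((Nat.card (lowerRamification K L 0) : ℕ) : ℝ) with hc
  have hc0 : 0 < c := Nat.cast_pos.2 Nat.card_pos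
  -- The slopes of the Herbrand function are at least `1 / c`, so it exceeds `s` at `s * c`.
  have h0 : 0 ≤ s * c := by positivity
  have h1 := (herbrand_growth L h0).1
  rw [herbrand_zero, sub_zero, sub_zero, ← hc, mul_assoc, mul_inv_cancel₀ hc0.ne', mul_one] at h1
  obtain ⟨u, hu, hus⟩ := intermediate_value_Icc h0 (herbrand_continuous L).continuousOn
    ⟨by rw [herbrand_zero]; exact hs.le, h1⟩
  exact ⟨u, by simp only [Set.mem_Ici]; linarith [hu.1], hus⟩

/-- The slopes of the Herbrand function are at most `1`. -/
theorem le_herbrand_invFunOn {s : ℝ} (hs : 0 < s) :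
    s ≤ Function.invFunOn (herbrand K L) (Set.Ici (-1)) s := by
  set u := Function.invFunOn (herbrand K L) (Set.Ici (-1)) s with hu
  have h1 : herbrand K L u = s := herbrand_invFunOn L hs
  have h2 : 0 ≤ u := by
    rw [← (herbrand_strictMono L).le_iff_le, h1, herbrand_zero]
    exact hs.le
  have := (herbrand_growth L h2).2
  rw [h1, herbrand_zero] at this
  linarith

theorem upperRamification_le {s s' : ℝ} (hs : 0 < s) (h : s ≤ s') :
    upperRamification K L s' ≤ upperRamification K L s := by
  refine lowerRamification_antitone L ?_
  rw [← (herbrand_strictMono L).le_iff_le, herbrand_invFunOn L hs,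
    herbrand_invFunOn L (hs.trans_le h)]
  exact h

theorem exists_lowerRamification_eq_bot : ∃ U : ℝ, ∀ u, U < u → lowerRamification K L u = ⊥ := by
  have key : ∀ σ : Gal(L/K), ∃ U : ℝ, σ ≠ 1 → ∀ u, σ ∈ lowerRamification K L u → u ≤ U := by
    intro σ
    by_cases hσ : σ = 1
    · exact ⟨0, fun h => absurd hσ h⟩
    obtain ⟨x, hx, hx0⟩ : ∃ x : L, σ x ≠ x ∧ 0 ≤ sepVal K (x : SeparableClosure K) := by
      obtain ⟨x, hx⟩ : ∃ x, σ x ≠ x := by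
        by_contra! h
        exact hσ (AlgEquiv.ext h)
      have hx0 : (x : SeparableClosure K) ≠ 0 := by
        intro h
        have : x = 0 := Subtype.ext h
        simp [this] at hx
      obtain ⟨r, hr⟩ := exists_sepVal_eq hx0
      rcases le_total 0 r with h | h
      · exact ⟨x, hx, by rw [hr]; exact WithTop.coe_nonneg.2 h⟩
      · refine ⟨x⁻¹, by simpa using hx, ?_⟩
        have h1 : sepVal K ((x⁻¹ : L) : SeparableClosure K) = ((-r : ℝ) : WithTop ℝ) := by
          change sepVal K ((x : SeparableClosure K)⁻¹) = _
          rw [AddValuation.map_inv, hr]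
          rfl
        rw [h1]
        exact WithTop.coe_nonneg.2 (by linarith)
    have hne : ((σ x - x : L) : SeparableClosure K) ≠ 0 := by
      intro h
      exact hx (sub_eq_zero.1 (Subtype.ext h))
    obtain ⟨r, hr⟩ := exists_sepVal_eq hne
    refine ⟨ramificationIndex K L.toIntermediateField * r, fun _ u hu => ?_⟩
    have hint : 0 ≤ fieldVal K L.toIntermediateField x := by
      rw [fieldVal]
      revert hx0
      induction sepVal K (x : SeparableClosure K) using WithTop.recTopCoe with
      | top => simp
      | coe s =>
        intro hs
        rw [WithTop.map_coe]
        exact WithTop.coe_nonneg.2 (mul_nonneg (Nat.cast_nonneg _) (WithTop.coe_nonneg.1 hs))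
    have h1 := hu x hint
    rw [fieldVal, hr, WithTop.map_coe, WithTop.coe_le_coe] at h1
    linarith
  choose U hU using key
  obtain ⟨B, hB⟩ := (Set.finite_range U).bddAbove
  refine ⟨B, fun u hu => (Subgroup.eq_bot_iff_forall _).2 fun σ hσ => ?_⟩
  by_contra h
  have := hU σ h u hσ
  have := hB (Set.mem_range_self σ)
  linarith

variable (K) in
theorem absUpperRamification_le {s s' : ℝ} (hs : 0 < s) (h : s ≤ s') :
    absUpperRamification K s' ≤ absUpperRamification K s :=
  iInf_mono fun L => Subgroup.comap_mono (upperRamification_le L hs h)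

/-- A homomorphism to a discrete group kills the upper ramification groups of large index. -/
theorem exists_absUpperRamification_le_ker {G : Type*} [Group G] [TopologicalSpace G]
    [DiscreteTopology G] (f : Gal(SeparableClosure K/K) →ₜ* G) :
    ∃ S : ℝ, 0 < S ∧ ∀ s, S < s → ∀ σ ∈ absUpperRamification K s, f σ = 1 := by
  have hnhds : {σ : Gal(SeparableClosure K/K) | f σ = 1} ∈ nhds 1 :=
    ((isOpen_discrete ({1} : Set G)).preimage f.continuous_toFun).mem_nhds (map_one f)
  obtain ⟨L, hL⟩ := (InfiniteGalois.krullTopology_mem_nhds_one_iff_of_isGalois _).1 hnhds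
  obtain ⟨U, hU⟩ := exists_lowerRamification_eq_bot L
  refine ⟨max U 1, by positivity, fun s hs σ hσ => hL ?_⟩
  have h1 : AlgEquiv.restrictNormalHom L σ ∈ upperRamification K L s := Subgroup.mem_iInf.1 hσ L
  have h2 := le_herbrand_invFunOn L (show 0 < s from (by positivity : (0 : ℝ) < max U 1).trans hs)
  rw [upperRamification, hU _ (((le_max_left U 1).trans_lt hs).trans_le h2), Subgroup.mem_bot] at h1
  intro x
  have h3 : ((AlgEquiv.restrictNormalHom L σ x : L) : SeparableClosure K) = σ x :=
    AlgEquiv.restrictNormal_commutes σ L x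
  rw [h1] at h3
  exact h3.symm

end Herbrand

section Integrability

open MeasureTheory

variable {K : Type*} [Field K] [ValuativeRel K] [TopologicalSpace K] [IsNonarchimedeanLocalField K]
variable {G : Type*} [Group G] [TopologicalSpace G]
variable {V : Type*} [AddCommGroup V] [Module K V]

theorem conductorIntegrand_of_le_one (f : Gal(SeparableClosure K/K) →ₜ* G)
    (ρ : Representation K G V) {t : ℝ} (ht : t ≤ 1) :
    conductorIntegrand f ρ t = conductorIntegrand f ρ 1 := by
  rcases ht.lt_or_eq with h | rfl
  · rw [conductorIntegrand, conductorIntegrand, truncatedRamification, truncatedRamification,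
      if_pos h, if_neg (lt_irrefl 1)]
  · rfl

theorem truncatedRamification_of_one_lt {t : ℝ} (ht : 1 < t) :
    truncatedRamification K t = absUpperRamification K (t - 1) := by
  simp [truncatedRamification, shiftedRamification, ht.not_gt, ht.ne']

theorem conductorIntegrand_antitoneOn [FiniteDimensional K V]
    (f : Gal(SeparableClosure K/K) →ₜ* G)
    (ρ : Representation K G V) : AntitoneOn (conductorIntegrand f ρ) (Set.Ioi 1) := by
  intro t ht t' ht' h
  refine sub_le_sub_left (Nat.cast_le.2 (charPairing_one_mono ρ (Subgroup.map_mono ?_))) _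
  rw [truncatedRamification_of_one_lt ht, truncatedRamification_of_one_lt ht']
  exact absUpperRamification_le K (sub_pos.2 ht) (by linarith)

/-- The integrand is constant up to `1`, then antitone and bounded, and finally zero. -/
theorem conductorIntegrand_integrableOn [DiscreteTopology G] [FiniteDimensional K V]
    (f : Gal(SeparableClosure K/K) →ₜ* G)
    (ρ : Representation K G V) : IntegrableOn (conductorIntegrand f ρ) (Set.Ioi 0) := by
  obtain ⟨S, hS, hker⟩ := exists_absUpperRamification_le_ker f
  have h1 : IntegrableOn (conductorIntegrand f ρ) (Set.Ioc 0 1) := by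
    refine IntegrableOn.congr_fun (f := fun _ => conductorIntegrand f ρ 1) ?_
      (fun t ht => (conductorIntegrand_of_le_one f ρ ht.2).symm) measurableSet_Ioc
    exact integrableOn_const measure_Ioc_lt_top.ne
  have h2 : IntegrableOn (conductorIntegrand f ρ) (Set.Ioc 1 (1 + S)) := by
    refine IntegrableOn.of_bound measure_Ioc_lt_top ?_ (Module.finrank K V) ?_
    · exact (aemeasurable_restrict_of_antitoneOn measurableSet_Ioi
        (conductorIntegrand_antitoneOn f ρ)).aestronglyMeasurable.mono_set Set.Ioc_subset_Ioi_self
    · refine Filter.Eventually.of_forall fun t => ?_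
      have := charPairing_le ρ
        ((truncatedRamification K t).map (f : Gal(SeparableClosure K/K) →* G)) 1
      have h3 : (charPairing ρ ((truncatedRamification K t).map
        (f : Gal(SeparableClosure K/K) →* G)) 1 : ℝ) ≤ Module.finrank K V := by exact_mod_cast this
      rw [conductorIntegrand, Real.norm_eq_abs, abs_of_nonneg (by linarith)]
      have : (0 : ℝ) ≤ (charPairing ρ ((truncatedRamification K t).map
        (f : Gal(SeparableClosure K/K) →* G)) 1 : ℝ) := Nat.cast_nonneg _
      linarith
  have h3 : IntegrableOn (conductorIntegrand f ρ) (Set.Ioi (1 + S)) := by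
    refine IntegrableOn.congr_fun (f := fun _ => (0 : ℝ)) (integrableOn_zero) (fun t ht => ?_)
      measurableSet_Ioi
    have ht' : 1 + S < t := ht
    rw [conductorIntegrand, charPairing_one_of_forall_eq_one, sub_self]
    rintro _ ⟨σ, hσ, rfl⟩
    rw [truncatedRamification_of_one_lt (by linarith)] at hσ
    exact hker (t - 1) (by linarith) σ hσ
  have h4 : Set.Ioi (0 : ℝ) = Set.Ioc 0 1 ∪ (Set.Ioc 1 (1 + S) ∪ Set.Ioi (1 + S)) := by
    rw [Set.Ioc_union_Ioi_eq_Ioi (by linarith), Set.Ioc_union_Ioi_eq_Ioi zero_le_one]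
  rw [h4]
  exact h1.union (h2.union h3)

end Integrability

/-! ### Functoriality of the fine conductor -/

section Functoriality

variable {K : Type*} [Field K] [ValuativeRel K] [TopologicalSpace K] [IsNonarchimedeanLocalField K]
variable {G : Type*} [Group G] [TopologicalSpace G] [DiscreteTopology G]

/-- The defining property of `γ_f`, which exists since `γ_{e₀(f)}` kills the kernel of `f` on the
inertia group. -/
theorem tameHom_apply [Finite G] (f : Gal(SeparableClosure K/K) →ₜ* G) (σ : inertia K) :
    tameHom f ⟨f σ, Subgroup.mem_map_of_mem (f : Gal(SeparableClosure K/K) →* G) σ.2⟩ =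
      tameCharacter K (tameIndex f) σ := by
  obtain ⟨hcop, hspec⟩ := tameIndex_spec f
  let q := (f : Gal(SeparableClosure K/K) →* G).subgroupMap (inertia K)
  have hq : Function.Surjective q := MonoidHom.subgroupMap_surjective _ _
  have hker : q.ker ≤ (tameCharacterHom hcop).ker := by
    intro τ hτ
    refine (hspec τ).1 ?_
    have h1 : f τ = 1 := congrArg Subtype.val hτ
    rw [h1]
    exact one_mem _
  refine Classical.epsilon_spec (p := fun γ : inertiaImage f →*
    rootsOfUnity (tameIndex f) (SeparableClosure K) => ∀ σ : inertia K,
    γ ⟨f σ, Subgroup.mem_map_of_mem (f : Gal(SeparableClosure K/K) →* G) σ.2⟩ =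
      tameCharacter K (tameIndex f) σ) ⟨q.liftOfSurjective hq ⟨tameCharacterHom hcop, hker⟩,
        fun τ => ?_⟩ σ
  exact MonoidHom.liftOfRightInverse_comp_apply q _ _ ⟨tameCharacterHom hcop, hker⟩ τ

theorem tameHom_pow_apply [Finite G] (f : Gal(SeparableClosure K/K) →ₜ* G) (d : ℕ) (σ : inertia K)
    (h : f σ ∈ inertiaImage f) :
    (((rootsOfUnity (tameIndex f) (SeparableClosure K)).subtype.comp (tameHom f)) ^ d) ⟨f σ, h⟩ =
      (tameCharacter K (tameIndex f) σ : (SeparableClosure K)ˣ) ^ d := by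
  rw [← tameHom_apply f σ]
  rfl

theorem tameCharacter_pow_of_eq_mul {N n k : ℕ} (h : N = n * k)
    (hN : N.Coprime (ringChar 𝓀[K])) (σ : inertia K) :
    (tameCharacter K N σ : (SeparableClosure K)ˣ) ^ k = tameCharacter K n σ := by
  subst h
  exact tameCharacter_mul_pow hN σ

theorem tameCharacter_pow {n : ℕ} (hn : n.Coprime (ringChar 𝓀[K])) (σ : inertia K) (m : ℕ) :
    tameCharacter K n (σ ^ m) = tameCharacter K n σ ^ m :=
  map_pow (tameCharacterHom hn) σ m

theorem tameCharacter_pow_self {n : ℕ} (hn : n.Coprime (ringChar 𝓀[K])) (σ : inertia K) :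
    tameCharacter K n (σ ^ n) = 1 := by
  rw [tameCharacter_pow hn]
  exact Subtype.ext ((mem_rootsOfUnity n _).1 (Subtype.property _))

variable {G' : Type*} [Group G'] [TopologicalSpace G']

theorem tameIndex_postcomp_dvd [Finite G] [Finite G'] [DiscreteTopology G']
    (φ : G →* G')
    (f : Gal(SeparableClosure K/K) →ₜ* G) : tameIndex (postcomp φ f) ∣ tameIndex f := by
  obtain ⟨hcop, hspec⟩ := tameIndex_spec f
  obtain ⟨hcop', hspec'⟩ := tameIndex_spec (postcomp φ f)
  obtain ⟨σ, hσ⟩ := exists_orderOf_tameCharacter_eq hcop'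
  rw [← hσ, orderOf_dvd_iff_pow_eq_one, ← tameCharacter_pow hcop', ← hspec']
  -- For `γ_{e₀(φ ∘ f)}(σ)` of full order, `σ ^ e₀(f)` is wild modulo the kernel of `f`.
  obtain ⟨w, hw, hwσ⟩ := (hspec (σ ^ tameIndex f)).2 (tameCharacter_pow_self hcop σ)
  exact ⟨w, hw, congrArg φ hwσ⟩

/-- The kernel of `φ` meets the inertia image in a subgroup that `γ_f` maps onto the roots of unity
of order `e₀(f) / e₀(φ ∘ f)`. -/
theorem exists_ker_tameCharacter_pow_ne_one [Finite G] [Finite G'] [DiscreteTopology G']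
    (φ : G →* G')
    (f : Gal(SeparableClosure K/K) →ₜ* G) {k d : ℕ}
    (hk : tameIndex f = tameIndex (postcomp φ f) * k) (hd : ¬ k ∣ d) :
    ∃ τ : inertia K, φ (f τ) = 1 ∧ tameCharacter K (tameIndex f) τ ^ d ≠ 1 := by
  obtain ⟨hcop, hspec⟩ := tameIndex_spec f
  obtain ⟨hcop', hspec'⟩ := tameIndex_spec (postcomp φ f)
  obtain ⟨σ, hσ⟩ := exists_orderOf_tameCharacter_eq hcop
  obtain ⟨w, hw, hwσ⟩ :=
    (hspec' (σ ^ tameIndex (postcomp φ f))).2 (tameCharacter_pow_self hcop' σ)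
  let w' : inertia K := ⟨w, wildInertia_le_inertia hw⟩
  have hw1 : tameCharacterHom hcop w' = 1 := (hspec w').1 ⟨w, hw, rfl⟩
  have hwσ' : φ (f w) = φ (f (σ ^ tameIndex (postcomp φ f) : inertia K)) := hwσ
  -- For `γ_{e₀(f)}(σ)` of full order, correct `σ ^ e₀(φ ∘ f)` by a wild element.
  refine ⟨σ ^ tameIndex (postcomp φ f) * w'⁻¹, ?_, fun h => hd ?_⟩
  · rw [Subgroup.coe_mul, Subgroup.coe_inv, map_mul, map_inv, map_mul, map_inv, ← hwσ',
      mul_inv_cancel]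
  · rw [← tameCharacterHom_apply hcop, map_mul, map_inv, hw1, inv_one, mul_one, map_pow, ← pow_mul,
      ← orderOf_dvd_iff_pow_eq_one, tameCharacterHom_apply, hσ] at h
    have h1 : tameIndex (postcomp φ f) * k ∣ tameIndex (postcomp φ f) * d := by rwa [← hk]
    exact Nat.dvd_of_mul_dvd_mul_left (Nat.pos_of_ne_zero (ne_zero_of_coprime hcop')) h1

variable {V : Type*} [AddCommGroup V] [Module K V]

theorem conductorIntegrand_postcomp (φ : G →* G') (f : Gal(SeparableClosure K/K) →ₜ* G)
    (ρ : Representation K G' V) :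
    conductorIntegrand (postcomp φ f) ρ = conductorIntegrand f (ρ.comp φ) := by
  funext t
  rw [conductorIntegrand, conductorIntegrand,
    charPairing_comp φ ρ (H := (truncatedRamification K t).map (f : Gal(SeparableClosure K/K) →* G))
      (χ := 1)]
  · rintro _ ⟨σ, hσ, rfl⟩
    exact ⟨⟨σ, hσ, rfl⟩, rfl⟩
  · rintro _ ⟨σ, hσ, rfl⟩
    exact ⟨f σ, ⟨σ, hσ, rfl⟩, rfl⟩

/-- The fine conductor of `φ ∘ f`. On the inertia image, `γ_{φ ∘ f} ∘ φ = γ_f ^ k` with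
`k = e₀(f) / e₀(φ ∘ f)`, and powers of `γ_f` with exponents not divisible by `k` do
not occur in a representation that is trivial on the kernel of `φ`. -/
theorem fineConductor_postcomp [Finite G] [Finite G'] [DiscreteTopology G']
    (φ : G →* G')
    (f : Gal(SeparableClosure K/K) →ₜ* G) (ρ : Representation K G' V) :
    fineConductor (postcomp φ f) ρ = fineConductor f (ρ.comp φ) := by
  obtain ⟨k, hk⟩ := tameIndex_postcomp_dvd φ f
  obtain ⟨hcop, -⟩ := tameIndex_spec f
  have hk0 : 0 < k := Nat.pos_of_ne_zero fun h => ne_zero_of_coprime hcop (by rw [hk, h, mul_zero])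
  rw [fineConductor, fineConductor, conductorIntegrand_postcomp]
  congr 1
  -- The divisor `d` of `e₀(φ ∘ f)` corresponds to the divisor `d * k` of `e₀(f)`; the other
  -- divisors of `e₀(f)` contribute nothing.
  refine Finset.sum_of_injOn (fun d => d * k)
    (fun a _ b _ hab => Nat.eq_of_mul_eq_mul_right hk0 hab)
    ?_ ?_ ?_
  · intro d hd
    obtain ⟨h1, h2⟩ := Nat.mem_properDivisors.1 hd
    refine Finset.mem_coe.2 (Nat.mem_properDivisors.2 ?_)
    rw [hk]
    exact ⟨Nat.mul_dvd_mul_right h1 k, Nat.mul_lt_mul_of_pos_right h2 hk0⟩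
  · intro d hd hd'
    obtain ⟨h1, h2⟩ := Nat.mem_properDivisors.1 hd
    have hkd : ¬ k ∣ d := by
      rintro ⟨c, rfl⟩
      refine hd' ⟨c, Finset.mem_coe.2 (Nat.mem_properDivisors.2 ?_), mul_comm c k⟩
      rw [hk, mul_comm k c] at h1 h2
      exact ⟨Nat.dvd_of_mul_dvd_mul_right hk0 h1, lt_of_mul_lt_mul_right h2 hk0.le⟩
    obtain ⟨τ, hτ, hne⟩ := exists_ker_tameCharacter_pow_ne_one φ f hk hkd
    have hmem : f τ ∈ inertiaImage f := ⟨τ, τ.2, rfl⟩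
    rw [charPairing_eq_zero _ ⟨f τ, hmem⟩, Nat.cast_zero, mul_zero]
    · change ρ (φ (f τ)) = 1
      rw [hτ, map_one]
    · rw [tameHom_pow_apply]
      exact fun h => hne (Subtype.ext h)
  · intro d hd
    have hdiv : tameIndex f / (d * k) = tameIndex (postcomp φ f) / d := by
      rw [hk, Nat.mul_div_mul_right _ _ hk0]
    rw [hdiv]
    congr 2
    refine charPairing_comp φ ρ ?_ ?_
    · rintro _ ⟨σ, hσ, rfl⟩
      refine ⟨⟨σ, hσ, rfl⟩, ?_⟩
      refine (tameHom_pow_apply (postcomp φ f) d ⟨σ, hσ⟩ ⟨σ, hσ, rfl⟩).trans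
        (Eq.trans ?_ (tameHom_pow_apply f (d * k) ⟨σ, hσ⟩ ⟨σ, hσ, rfl⟩).symm)
      rw [mul_comm d k, pow_mul, tameCharacter_pow_of_eq_mul hk hcop]
    · rintro _ ⟨σ, hσ, rfl⟩
      exact ⟨f σ, ⟨σ, hσ, rfl⟩, rfl⟩

theorem fineConductor_congr {W : Type*} [AddCommGroup W] [Module K W]
    {G : Type*} [Group G] [TopologicalSpace G] (f : Gal(SeparableClosure K/K) →ₜ* G)
    {ρ : Representation K G V} {τ : Representation K G W}
    (e : V ≃ₗ[K] W) (he : ∀ g v, e (ρ g v) = τ g (e v)) :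
    fineConductor f ρ = fineConductor f τ := by
  have h : conductorIntegrand f ρ = conductorIntegrand f τ := by
    funext t
    rw [conductorIntegrand, conductorIntegrand, charPairing_congr e he, e.finrank_eq]
  rw [fineConductor, fineConductor, h]
  simp_rw [charPairing_congr e he]

/-- Conjugation by `g` is composition with an inner automorphism, and `ρ(g)` identifies `ρ` with its
conjugate. -/
theorem fineConductor_conjugate [Finite G] (f : Gal(SeparableClosure K/K) →ₜ* G)
    (ρ : Representation K G V) (g : G) :
    fineConductor (conjugate g f) ρ = fineConductor f ρ := by
  have h : conjugate g f = postcomp (MulAut.conj g).toMonoidHom f := rfl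
  rw [h, fineConductor_postcomp]
  refine fineConductor_congr f (LinearEquiv.ofLinearMap (ρ g⁻¹) (ρ g) ?_ ?_) fun h v => ?_
  · rw [← Module.End.mul_eq_comp, ← map_mul, inv_mul_cancel, map_one, Module.End.one_eq_id]
  · rw [← Module.End.mul_eq_comp, ← map_mul, mul_inv_cancel, map_one, Module.End.one_eq_id]
  · change ρ g⁻¹ (ρ (g * h * g⁻¹) v) = ρ h (ρ g⁻¹ v)
    rw [← Module.End.mul_apply, ← Module.End.mul_apply, ← map_mul, ← map_mul]
    congr 2
    group

theorem fineConductor_of_subsingleton {G : Type*} [Group G] [TopologicalSpace G]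
    [Subsingleton G] (f : Gal(SeparableClosure K/K) →ₜ* G)
    (ρ : Representation K G V) : fineConductor f ρ = 0 := by
  have h1 : tameIndex f = 1 := by
    rw [tameIndex, Subsingleton.elim (inertiaImage f)
      ((shiftedRamification K 1).map (f : Gal(SeparableClosure K/K) →* G)), Subgroup.relIndex_self]
  have h2 : conductorIntegrand f ρ = fun _ => 0 := by
    funext t
    rw [conductorIntegrand, charPairing_one_of_forall_eq_one ρ fun g _ => Subsingleton.elim g 1,
      sub_self]
  have h3 : (tameIndex f).properDivisors = ∅ := by rw [h1, Nat.properDivisors_one]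
  rw [fineConductor, h2, h3]
  simp

/-- The trivial representation factors through the trivial group. -/
theorem fineConductor_trivial [Finite G] (f : Gal(SeparableClosure K/K) →ₜ* G) :
    fineConductor f (Representation.trivial K G K) = 0 := by
  have h : Representation.trivial K G K =
      (Representation.trivial K Unit K).comp (1 : G →* Unit) := rfl
  rw [h, ← fineConductor_postcomp]
  exact fineConductor_of_subsingleton _ _

theorem fineConductor_prod {W : Type*} [AddCommGroup W] [Module K W] [FiniteDimensional K V]
    [FiniteDimensional K W] (f : Gal(SeparableClosure K/K) →ₜ* G) (ρ : Representation K G V)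
    (τ : Representation K G W) :
    fineConductor f (ρ.prod τ) = fineConductor f ρ + fineConductor f τ := by
  have h : conductorIntegrand f (ρ.prod τ) =
      fun t => conductorIntegrand f ρ t + conductorIntegrand f τ t := by
    funext t
    rw [conductorIntegrand, conductorIntegrand, conductorIntegrand, charPairing_prod,
      Module.finrank_prod]
    push_cast
    ring
  rw [fineConductor, fineConductor, fineConductor, h, MeasureTheory.integral_add
    (conductorIntegrand_integrableOn f ρ) (conductorIntegrand_integrableOn f τ),
    add_add_add_comm, ← Finset.sum_add_distrib]
  congr 1
  refine Finset.sum_congr rfl fun d _ => ?_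
  rw [charPairing_prod]
  push_cast
  ring

end Functoriality

end FineArtin

end

theorem mainTheorem5 (K : Type*) [Field K] [ValuativeRel K] [TopologicalSpace K]
    [IsNonarchimedeanLocalField K] :
    (∀ (G : Type*) [Group G] [Finite G] [TopologicalSpace G] [DiscreteTopology G],
      (Nat.card G : K) ≠ 0 → ∀ f : Gal(SeparableClosure K/K) →ₜ* G,
        (∀ (V : Type*) [AddCommGroup V] [Module K V] [FiniteDimensional K V]
          (ρ : Representation K G V),
          MeasureTheory.IntegrableOn (FineArtin.conductorIntegrand f ρ) (Set.Ioi 0)) ∧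
        FineArtin.fineConductor f (Representation.trivial K G K) = 0 ∧
        (∀ (V₁ V₂ : Type*) [AddCommGroup V₁] [Module K V₁] [FiniteDimensional K V₁]
          [AddCommGroup V₂] [Module K V₂] [FiniteDimensional K V₂]
          (ρ₁ : Representation K G V₁) (ρ₂ : Representation K G V₂),
          FineArtin.fineConductor f (ρ₁.prod ρ₂) =
            FineArtin.fineConductor f ρ₁ + FineArtin.fineConductor f ρ₂) ∧
        (∀ (V : Type*) [AddCommGroup V] [Module K V] [FiniteDimensional K V]
          (ρ : Representation K G V) (g : G),
          FineArtin.fineConductor (FineArtin.conjugate g f) ρ = FineArtin.fineConductor f ρ)) ∧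
    (∀ (G₁ G₂ : Type*) [Group G₁] [Finite G₁] [TopologicalSpace G₁] [DiscreteTopology G₁]
      [Group G₂] [Finite G₂] [TopologicalSpace G₂] [DiscreteTopology G₂],
      (Nat.card G₁ : K) ≠ 0 → (Nat.card G₂ : K) ≠ 0 →
      ∀ (φ : G₁ →* G₂) (f : Gal(SeparableClosure K/K) →ₜ* G₁)
        (V : Type*) [AddCommGroup V] [Module K V] [FiniteDimensional K V]
        (ρ : Representation K G₂ V),
        FineArtin.fineConductor (FineArtin.postcomp φ f) ρ =
          FineArtin.fineConductor f (ρ.comp φ)) := by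
  refine ⟨fun G _ _ _ _ _ f => ⟨fun V _ _ _ ρ => ?_, ?_, fun V₁ V₂ _ _ _ _ _ _ ρ₁ ρ₂ => ?_,
    fun V _ _ _ ρ g => ?_⟩, fun G₁ G₂ _ _ _ _ _ _ _ _ _ _ φ f V _ _ _ ρ => ?_⟩
  · exact FineArtin.conductorIntegrand_integrableOn f ρ
  · exact FineArtin.fineConductor_trivial f
  · exact FineArtin.fineConductor_prod f ρ₁ ρ₂
  · exact FineArtin.fineConductor_conjugate f ρ g
  · exact FineArtin.fineConductor_postcomp φ f ρ
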